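/- Work on the jet space $J^2(\mathbb R^2,\mathbb R)=\mathbb R^8$ with coordinates $(x,y,z,p,q,r,s,t)$, in the smooth category. Let $F$ be a smooth function on an open set $U\subset J^2$ with locus $L_F=\{F=0\}$, and let $i_F:\Sigma\to J^2$ be a nondegenerate parametrization of $F=0$: $\Sigma\subset\mathbb R^7$ is open, $i_F$ is a smooth map of maximal rank with image $L_F$, transverse to the fibres of $J^2\to J^1$, $(x,\dots,t)\mapsto(x,y,z,p,q)$. The equation is *hyperbolic* at $w\in\Sigma$ if $F_rF_t-\tfrac14F_s^2<0$ at $i_F(w)$. Let $\omega^1,\omega^2,\omega^3$ be the pullbacks by $i_F$ of $dz-p\,dx-q\,dy$, $dp-r\,dx-s\,dy$, $dq-s\,dx-t\,dy$, and let $I_F=\{\omega^1,\omega^2,\omega^3\}$ be the Pfaffian system they generate. Near a hyperbolic point, $I_F$ has exactly two subsystems $M_1,M_2$ of rank two (distinct at every point) that are isotropic for the symmetric bilinear form $\langle\varphi,\psi\rangle_7\,\mathrm{Vol}=d\varphi\wedge d\psi\wedge\omega^1\wedge\omega^2\wedge\omega^3$. The *class* of a Pfaffian system $I$ at $w$ is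 the dimension of the annihilator of its Cauchy characteristic space $\{v\in T_w\Sigma: v\in I^\perp,\ v\lrcorner dI\subset I\}$. At a hyperbolic point $w$ the equation is *Monge–Ampère*, *Goursat* or *generic* if $\{\mathrm{class}(M_1),\mathrm{class}(M_2)\}$ at $w$ is $\{6\}$, $\{6,7\}$ or $\{7\}$, respectively. Put $$\lambda_+=\tfrac12F_s+\sqrt{|F_rF_t-\tfrac14F_s^2|},$$ $$\tilde I_1=\det\begin{pmatrix}F_r&F_s&F_t\\ \lambda_+&F_t&0\\ (F_t/\lambda_+)_r&(F_t/\lambda_+)_s&(F_t/\lambda_+)_t\end{pmatrix},\quad \tilde I_2=\det\begin{pmatrix}0&F_r&\lambda_+\\ F_r&F_s&F_t\\ (F_r/\lambda_+)_r&(F_r/\lambda_+)_s&(F_r/\lambda_+)_t\end{pmatrix},$$ and $\Delta^F_{k,l}=F_k^2F_{ll}-2F_kF_lF_{kl}+F_l^2F_{kk}$. **(1)** Let $F=F(x,y,z,p,q,r,t)$ not depend on $s$. The equation $F=0$ is hyperbolic at $w$ iff $F_rF_t<0$ at $i_F(w)$. At each hyperbolic point $w$ it is either Monge–Ampère or generic: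 it is Monge–Ampère iff $\Delta^F_{r,t}(i_F(w))=0$, and generic iff $\Delta^F_{r,t}(i_F(w))\ne0$. It is Monge–Ampère at all points near $w$ iff, near $i_F(w)$, its locus is the zero locus of a function $ar+bt+c$ with $a,b,c$ smooth functions of $(x,y,z,p,q)$. At every point of $U$ where $F_rF_t<0$, $$\tilde I_1=\frac{-F_t^2\,\Delta^F_{r,t}}{2(-F_tF_r)^{3/2}},\qquad \tilde I_2=\frac{-F_r^2\,\Delta^F_{r,t}}{2(-F_tF_r)^{3/2}}.$$ **(2)** Let $G=G(x,y,z,p,q,r,s)$ not depend on $t$. The equation $G=0$ is hyperbolic at $w$ iff $G_s\neq0$ at $i_G(w)$. At each hyperbolic point $w$ it is either Monge–Ampère or Goursat: it is Monge–Ampère iff $\Delta^G_{r,s}(i_G(w))=0$, and Goursat iff $\Delta^G_{r,s}(i_G(w))\ne0$. It is Monge–Ampère at all points near $w$ iff, near $i_G(w)$, its locus is the zero locus of a function $ar+bs+c$ with $a,b,c$ smooth functions of $(x,y,z,p,q)$. At every point of $U$ where $G_s>0$, $$\tilde I_1=0,\qquad \tilde I_2=-\Delta^G_{r,s}/G_s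 .$$ **(3)** Let $f=f(x,y,z,p,q,s)$ not depend on $r,t$. The equation $rt=f$, i.e. $F=rt-f=0$, is hyperbolic at $w$ iff $4f<f_s^2$ at $i_F(w)$. At each hyperbolic point $w$ where $rt\neq0$, it is Monge–Ampère iff $f_{ss}=2$ at $i_F(w)$, generic iff $f_{ss}\neq2$ there, and never Goursat. At every point of $U$ where $f_s^2-4rt>0$, and where the respective $\lambda_+$ is nonzero (which is automatic if $rt\ne0$), $$(\tilde I_1,\tilde I_2)=\frac{c}{\sqrt{f_s^2-4rt}}\,(r^2,t^2),$$ with $c=f_{ss}-2$ for the function $rt-f$, $c=-(f_{ss}-2)$ for the function $f-rt$, and $c=-(f_{ss}+2)$ for the function $rt+f$. -/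

import Mathlib

open scoped ContDiff Topology

noncomputable section

/-- The 2-jet space `J²(ℝ²,ℝ)` with its standard coordinates `(x,y,z,p,q,r,s,t)`. -/
abbrev Jet2 := Fin 8 → ℝ

/-- The 1-jet space `J¹(ℝ²,ℝ)` with its standard coordinates `(x,y,z,p,q)`. -/
abbrev Jet1 := Fin 5 → ℝ

/-- The space `ℝ⁷` whose open subsets parametrize equations. -/
abbrev Param := Fin 7 → ℝ

namespace Jet2

abbrev x : Fin 8 := 0
abbrev y : Fin 8 := 1
abbrev z : Fin 8 := 2
abbrev p : Fin 8 := 3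
abbrev q : Fin 8 := 4
abbrev r : Fin 8 := 5
abbrev s : Fin 8 := 6
abbrev t : Fin 8 := 7

end Jet2

/-- The natural projection `J² → J¹`, `(x,y,z,p,q,r,s,t) ↦ (x,y,z,p,q)`. -/
def jetProj : Jet2 →L[ℝ] Jet1 :=
  ContinuousLinearMap.pi fun k : Fin 5 => ContinuousLinearMap.proj (Fin.castLE (by norm_num) k)

/-- The partial derivative of `F` with respect to the `k`-th jet coordinate. -/
def pd (k : Fin 8) (F : Jet2 → ℝ) (j : Jet2) : ℝ := fderiv ℝ F j (Pi.single k 1)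

/-- On `U`, the function `F` depends only on the coordinates in `C`. -/
def DependsOnlyOn (U : Set Jet2) (F : Jet2 → ℝ) (C : Set (Fin 8)) : Prop :=
  ∀ j ∈ U, ∀ j' ∈ U, (∀ k ∈ C, j k = j' k) → F j = F j'

/-! ### Equations and their parametrizations -/

/-- The locus `L_F` of the equation `F = 0`, for `F` given on `U`. -/
def locus (U : Set Jet2) (F : Jet2 → ℝ) : Set Jet2 := {j | j ∈ U ∧ F j = 0}

/-- `i : S → J²` is a nondegenerate parametrization of the equation `F = 0`: a smooth map of
maximal rank on an open set `S ⊆ ℝ⁷`, with image the locus, transverse to the fibres of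
`J² → J¹`. -/
structure IsNondegenerateParametrization (U : Set Jet2) (F : Jet2 → ℝ)
    (S : Set Param) (i : Param → Jet2) : Prop where
  isOpen : IsOpen S
  smooth : ContDiffOn ℝ ∞ i S
  image_eq : i '' S = locus U F
  maximal_rank : ∀ w ∈ S, Function.Injective (fderiv ℝ i w)
  transverse : ∀ w ∈ S,
    LinearMap.range (fderiv ℝ i w : Param →ₗ[ℝ] Jet2) ⊔
      LinearMap.ker (jetProj : Jet2 →ₗ[ℝ] Jet1) = ⊤

/-- The function `F_r F_t - F_s² / 4` on `J²`. -/
def discr (F : Jet2 → ℝ) (j : Jet2) : ℝ :=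
  pd Jet2.r F j * pd Jet2.t F j - (pd Jet2.s F j) ^ 2 / 4

/-- The equation `F = 0`, parametrized by `i`, is hyperbolic at `w`: `Δ(w) < 0`, where
`Δ = i^*(F_r F_t - F_s² / 4)`. -/
def IsHyperbolicAt (F : Jet2 → ℝ) (i : Param → Jet2) (w : Param) : Prop :=
  discr F (i w) < 0

/-! ### Differential forms and Pfaffian systems on `ℝ⁷` -/

/-- Differential one-forms. -/
abbrev OneForm := Param → Param [⋀^Fin 1]→L[ℝ] ℝ

/-- The exterior product `σ ∧ α` of a covector and an alternating `n`-form: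
`(σ ∧ α)(v₀,…,vₙ) = ∑ₖ (-1)ᵏ σ(vₖ) α(v₀,…,vₖ₋₁,vₖ₊₁,…,vₙ)`. -/
def wedgeOne {n : ℕ} (σ : Param [⋀^Fin 1]→L[ℝ] ℝ) (α : Param [⋀^Fin n]→ₗ[ℝ] ℝ) :
    Param [⋀^Fin (n + 1)]→ₗ[ℝ] ℝ :=
  AlternatingMap.alternatizeUncurryFin
    ((((ContinuousAlternatingMap.ofSubsingleton ℝ Param ℝ (0 : Fin 1)).symm σ :
      Param →L[ℝ] ℝ) : Param →ₗ[ℝ] ℝ).smulRight α)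

theorem form_add_left (α : Param [⋀^Fin 2]→L[ℝ] ℝ) (a b c : Param) :
    α ![a + b, c] = α ![a, c] + α ![b, c] := by
  exact α.map_vecCons_add ![c] a b

theorem form_add_right (α : Param [⋀^Fin 2]→L[ℝ] ℝ) (a b c : Param) :
    α ![c, a + b] = α ![c, a] + α ![c, b] := by
  have e : ∀ u : Param, Function.update ![c, 0] 1 u = ![c, u] := by
    intro u; ext k; fin_cases k <;> rfl
  have h := α.map_update_add ![c, 0] 1 a b
  rwa [e, e, e] at h

theorem form_smul_left (α : Param [⋀^Fin 2]→L[ℝ] ℝ) (k : ℝ) (a c : Param) :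
    α ![k • a, c] = k * α ![a, c] := by
  exact α.map_vecCons_smul ![c] k a

theorem form_smul_right (α : Param [⋀^Fin 2]→L[ℝ] ℝ) (k : ℝ) (a c : Param) :
    α ![c, k • a] = k * α ![c, a] := by
  have e : ∀ u : Param, Function.update ![c, 0] 1 u = ![c, u] := by
    intro u; ext k; fin_cases k <;> rfl
  have h := α.map_update_smul ![c, 0] 1 k a
  rwa [e, e] at h

theorem form_same (α : Param [⋀^Fin 2]→L[ℝ] ℝ) (a : Param) : α ![a, a] = 0 :=
  α.map_eq_zero_of_eq ![a, a] (i := 0) (j := 1) rfl (by decide)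

theorem form_swap (α : Param [⋀^Fin 2]→L[ℝ] ℝ) (a b : Param) : α ![a, b] = -α ![b, a] := by
  have h := form_same α (a + b)
  rw [form_add_left, form_add_right, form_add_right, form_same, form_same] at h
  linarith

/-- The exterior product of two alternating 2-forms, by summing over the (2,2)-shuffles. -/
def wedgeTwo (α β : Param [⋀^Fin 2]→L[ℝ] ℝ) : Param [⋀^Fin 4]→ₗ[ℝ] ℝ where
  toFun v :=
    α ![v 0, v 1] * β ![v 2, v 3] - α ![v 0, v 2] * β ![v 1, v 3] + α ![v 0, v 3] * β ![v 1, v 2]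
    + α ![v 1, v 2] * β ![v 0, v 3] - α ![v 1, v 3] * β ![v 0, v 2] + α ![v 2, v 3] * β ![v 0, v 1]
  map_update_add' := by
    intro inst v k a b
    obtain rfl : inst = instDecidableEqFin 4 := Subsingleton.elim _ _
    fin_cases k <;> simp [Function.update, form_add_left, form_add_right] <;> ring
  map_update_smul' := by
    intro inst v k c a
    obtain rfl : inst = instDecidableEqFin 4 := Subsingleton.elim _ _
    fin_cases k <;> simp [Function.update, form_smul_left, form_smul_right] <;> ring
  map_eq_zero_of_eq' := by
    intro v k l h hkl
    have hs := form_swap α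
    have ht := form_swap β
    have ha := form_same α
    have hb := form_same β
    fin_cases k <;> fin_cases l <;> simp at h hkl <;> simp only [h, ha, hb] <;>
      (try simp only [hs (v 2) (v 1), ht (v 2) (v 1), hs (v 1) (v 0), ht (v 1) (v 0),
        hs (v 2) (v 0), ht (v 2) (v 0), hs (v 3) (v 1), ht (v 3) (v 1), hs (v 3) (v 2),
        ht (v 3) (v 2)]) <;> ring

/-- The Pfaffian system on `V` generated by `φ`: the `C^∞(V)`-module of one-forms spanned by
the `φ a` (values outside `V` are irrelevant). -/
def generated {k : ℕ} (V : Set Param) (φ : Fin k → OneForm) : Set OneForm :=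
  {η | ∃ g : Fin k → Param → ℝ, (∀ a, ContDiffOn ℝ ∞ (g a) V) ∧
    ∀ w ∈ V, η w = ∑ a, g a w • φ a w}

/-- The space of covectors at `w` given by the members of a Pfaffian system `I`. -/
def valuesAt (I : Set OneForm) (w : Param) : Submodule ℝ (Param [⋀^Fin 1]→L[ℝ] ℝ) :=
  Submodule.span ℝ {α | ∃ η ∈ I, α = η w}

/-- The Cauchy characteristic space of `I` at `w`: the vectors `v ∈ I^⊥` with `v ⌟ dI ⊆ I`. -/
def cauchyChar (I : Set OneForm) (w : Param) : Submodule ℝ Param where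
  carrier := {v | ∀ η ∈ I, η w ![v] = 0 ∧ (extDeriv η w).curryLeft v ∈ valuesAt I w}
  add_mem' := by
    intro a b ha hb η hη
    obtain ⟨h1, h2⟩ := ha η hη
    obtain ⟨h3, h4⟩ := hb η hη
    refine ⟨?_, ?_⟩
    · have h5 : η w ![a + b] = η w ![a] + η w ![b] := by
        exact (η w).map_vecCons_add ![] a b
      rw [h5, h1, h3, add_zero]
    · rw [map_add]
      exact add_mem h2 h4
  zero_mem' := by
    intro η _
    refine ⟨(η w).map_coord_zero 0 (by simp), ?_⟩
    rw [map_zero]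
    exact zero_mem _
  smul_mem' := by
    intro c a ha η hη
    obtain ⟨h1, h2⟩ := ha η hη
    refine ⟨?_, ?_⟩
    · have h5 : η w ![c • a] = c * η w ![a] := by
        exact (η w).map_vecCons_smul ![] c a
      rw [h5, h1, mul_zero]
    · rw [map_smul]
      exact Submodule.smul_mem _ _ h2

/-- The class of `I` at `w`: the rank of its Cartan system, the annihilator of the Cauchy
characteristic space. -/
def classAt (I : Set OneForm) (w : Param) : ℕ :=
  Module.finrank ℝ (cauchyChar I w).dualAnnihilator

/-! ### The contact system and the characteristic subsystems `M₁`, `M₂` -/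

/-- The coordinate one-form `dx_k` on `J²`. -/
def dcoord (k : Fin 8) : Jet2 [⋀^Fin 1]→L[ℝ] ℝ :=
  ContinuousAlternatingMap.ofSubsingleton ℝ Jet2 ℝ (0 : Fin 1) (ContinuousLinearMap.proj k)

/-- The contact forms `θ¹ = dz - p dx - q dy`, `θ² = dp - r dx - s dy`,
`θ³ = dq - s dx - t dy` on `J²`. -/
def contactForm : Fin 3 → Jet2 → Jet2 [⋀^Fin 1]→L[ℝ] ℝ :=
  ![fun j => dcoord Jet2.z - j Jet2.p • dcoord Jet2.x - j Jet2.q • dcoord Jet2.y,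
    fun j => dcoord Jet2.p - j Jet2.r • dcoord Jet2.x - j Jet2.s • dcoord Jet2.y,
    fun j => dcoord Jet2.q - j Jet2.s • dcoord Jet2.x - j Jet2.t • dcoord Jet2.y]

/-- The pulled back contact forms `ω^a = i^* θ^a`. -/
def omegaForm (i : Param → Jet2) (a : Fin 3) : OneForm := fun w =>
  (contactForm a (i w)).compContinuousLinearMap (fderiv ℝ i w)

/-- The Pfaffian system `I_F = {ω¹, ω², ω³}`, over the open set `V`. -/
def contactSystem (i : Param → Jet2) (V : Set Param) : Set OneForm :=
  generated V (omegaForm i)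

/-- The 7-form `dη ∧ dζ ∧ ω¹ ∧ ω² ∧ ω³ = ⟨η, ζ⟩₇ Vol` at `w`. (The even form `dη ∧ dζ` commutes
with the other factors.) -/
def pairing (i : Param → Jet2) (η ζ : OneForm) (w : Param) : Param [⋀^Fin 7]→ₗ[ℝ] ℝ :=
  wedgeOne (omegaForm i 0 w) (wedgeOne (omegaForm i 1 w) (wedgeOne (omegaForm i 2 w)
    (wedgeTwo (extDeriv η w) (extDeriv ζ w))))

/-- `M` is, over `V`, a subsystem of rank two of `I_F` that is isotropic for `⟨·,·⟩₇`. -/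
def IsCharacteristicSystem (i : Param → Jet2) (V : Set Param) (M : Set OneForm) : Prop :=
  (∃ φ : Fin 2 → OneForm, M = generated V φ ∧ (∀ a, φ a ∈ contactSystem i V) ∧
    ∀ w ∈ V, LinearIndependent ℝ fun a => φ a w) ∧
  ∀ η ∈ M, ∀ ζ ∈ M, ∀ w ∈ V, pairing i η ζ w = 0

/-- `M₁`, `M₂` are the two characteristic systems over `V`, in some labelling. -/
def IsCharacteristicPair (i : Param → Jet2) (V : Set Param) (M₁ M₂ : Set OneForm) : Prop :=
  IsCharacteristicSystem i V M₁ ∧ IsCharacteristicSystem i V M₂ ∧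
    ∀ w ∈ V, valuesAt M₁ w ≠ valuesAt M₂ w

/-- The characteristic systems `M₁`, `M₂`, defined near `w`, have classes `c₁`, `c₂` at `w`,
for some labelling of the pair. -/
def HasClassesAt (i : Param → Jet2) (S : Set Param) (w : Param) (c₁ c₂ : ℕ) : Prop :=
  ∃ V ⊆ S, IsOpen V ∧ w ∈ V ∧ ∃ M₁ M₂ : Set OneForm, IsCharacteristicPair i V M₁ M₂ ∧
    classAt M₁ w = c₁ ∧ classAt M₂ w = c₂

/-- Type 6-6 at `w`. -/
def IsMongeAmpereAt (i : Param → Jet2) (S : Set Param) (w : Param) : Prop :=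
  HasClassesAt i S w 6 6

/-- Type 6-7 at `w` (the labelling of the pair is free, so the order does not matter). -/
def IsGoursatAt (i : Param → Jet2) (S : Set Param) (w : Param) : Prop :=
  HasClassesAt i S w 6 7

/-- Type 7-7 at `w`. -/
def IsGenericAt (i : Param → Jet2) (S : Set Param) (w : Param) : Prop :=
  HasClassesAt i S w 7 7

/-! ### The relative invariants and the quantities in the classification -/

/-- `λ₊ = F_s / 2 + √|F_r F_t - F_s² / 4|`. -/
def lambdaPlus (F : Jet2 → ℝ) (j : Jet2) : ℝ := pd Jet2.s F j / 2 + √|discr F j|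

/-- The function `Ĩ₁` on `J²`. -/
def ITilde₁ (F : Jet2 → ℝ) (j : Jet2) : ℝ :=
  Matrix.det !![pd Jet2.r F j, pd Jet2.s F j, pd Jet2.t F j;
    lambdaPlus F j, pd Jet2.t F j, 0;
    pd Jet2.r (fun j' => pd Jet2.t F j' / lambdaPlus F j') j,
    pd Jet2.s (fun j' => pd Jet2.t F j' / lambdaPlus F j') j,
    pd Jet2.t (fun j' => pd Jet2.t F j' / lambdaPlus F j') j]

/-- The function `Ĩ₂` on `J²`. -/
def ITilde₂ (F : Jet2 → ℝ) (j : Jet2) : ℝ :=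
  Matrix.det !![0, pd Jet2.r F j, lambdaPlus F j;
    pd Jet2.r F j, pd Jet2.s F j, pd Jet2.t F j;
    pd Jet2.r (fun j' => pd Jet2.r F j' / lambdaPlus F j') j,
    pd Jet2.s (fun j' => pd Jet2.r F j' / lambdaPlus F j') j,
    pd Jet2.t (fun j' => pd Jet2.r F j' / lambdaPlus F j') j]

/-- `Δ_{k,l}^F = F_k² F_{ll} - 2 F_k F_l F_{kl} + F_l² F_{kk}`. -/
def deltaForm (k l : Fin 8) (F : Jet2 → ℝ) (j : Jet2) : ℝ :=
  (pd k F j) ^ 2 * pd l (pd l F) j - 2 * pd k F j * pd l F j * pd l (pd k F) j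
    + (pd l F j) ^ 2 * pd k (pd k F) j

/-- Near `j₀`, the locus of `F = 0` is the zero locus of a function that is affine in the two
coordinates `k`, `l`, with coefficients smooth functions of `(x,y,z,p,q)`. -/
def LocusIsAffineNear (U : Set Jet2) (F : Jet2 → ℝ) (k l : Fin 8) (j₀ : Jet2) : Prop :=
  ∃ W : Set Jet2, IsOpen W ∧ j₀ ∈ W ∧ W ⊆ U ∧ ∃ a b c : Jet1 → ℝ,
    ContDiffOn ℝ ∞ a (jetProj '' W) ∧ ContDiffOn ℝ ∞ b (jetProj '' W) ∧
    ContDiffOn ℝ ∞ c (jetProj '' W) ∧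
    ∀ j ∈ W, j ∈ locus U F ↔ a (jetProj j) * j k + b (jetProj j) * j l + c (jetProj j) = 0

end

/-! ### Exterior derivatives of one-forms and of the pulled-back contact forms. -/

noncomputable section

/-! In the fibre coordinates `(r,s,t)` put N(a,b) = (b², -ab, a²) (`nullVec`). This vector is
tangent to the equation exactly when (a,b) is null for the quadratic form F_t a² - F_s ab + F_r b²
(`charQuad`), and hyperbolicity says that this form has two distinct real null directions.
Evaluating the 7-form that defines the pairing on a basis adapted to these directions shows that it
polarizes the product of the two linear forms vanishing on them (`pairing_eq_zero_iff`). So the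
isotropic rank-two subsystems are exactly {ω¹, aω² + bω³} for the two null (a,b)
(`IsCharacteristicSystem.isBranch`, `isCharacteristicSystem_charGen`).

A Cauchy characteristic vector of such a system is a multiple of the vector u lying over N(a,b), and
u itself is one iff the ratio a:b is stationary along u (`isCharVector_charGen_iff`). The
characteristic space is therefore a line or zero, and the class is 6 or 7. Differentiating the
equation of the null cone along N(a,b) turns stationarity into Hess F(N,N) = 0
(`stationary_iff_nullHess`). Thus the type is read off from two numbers (`exists_type_iff`), and the
relative invariants are these Hessians, for suitable representatives, divided by a nonzero factor
(`ITilde₁_eq_nullHess`, `ITilde₂_eq_nullHess`).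

The rest is algebra on Hess F(N,N). Without `s`, both values are nonzero multiples of the same Δ, so
both classes agree. Without `t`, one null direction is N = ∂_t, where the Hessian vanishes, and the
other value is a nonzero multiple of Δ. For σrt + τf the value is a²b²(2σ + τf_ss), and ab ≠ 0 when
rt ≠ 0.

Finally, Δ is the numerator of the curvature of the curve cut out by F = 0 in a fibre plane. If it
vanishes along the locus, the slope of that curve is constant and the curve is a line
(`locusIsAffineNear_of_deltaForm`). Conversely, F vanishes to second order along a line in its locus
(`deltaForm_eq_zero_of_affine`). -/

theorem eval_ofSubsingleton (η : Param [⋀^Fin 1]→L[ℝ] ℝ) (v : Param) :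
    (ContinuousAlternatingMap.ofSubsingleton ℝ Param ℝ (0 : Fin 1)).symm η v = η ![v] := by
  simp
  congr 1
  ext k; fin_cases k; rfl

/-- Cartan's formula for the exterior derivative of a one-form. -/
theorem extDeriv_oneForm_apply {E : Type*} [NormedAddCommGroup E] [NormedSpace ℝ E]
    {η : E → E [⋀^Fin 1]→L[ℝ] ℝ} {w : E} (h : DifferentiableAt ℝ η w) (u v : E) :
    extDeriv η w ![u, v] =
      fderiv ℝ (fun w' => η w' ![v]) w u - fderiv ℝ (fun w' => η w' ![u]) w v := by
  have e1 : Fin.removeNth (0 : Fin 2) ![u, v] = ![v] := by ext k; fin_cases k; rfl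
  have e2 : Fin.removeNth (1 : Fin 2) ![u, v] = ![u] := by ext k; fin_cases k; rfl
  rw [extDeriv_apply h]
  simp [Fin.sum_univ_two, e1, e2]
  ring

/-- Leibniz rule d(gφ) = dg ∧ φ + g dφ. Equality is asked only near `w`, since members of a Pfaffian
system over `V` are arbitrary outside `V`. -/
theorem extDeriv_sum_smul {k : ℕ} {w : Param} {η : OneForm} {g : Fin k → Param → ℝ}
    {φ : Fin k → OneForm} (hη : ∀ᶠ w' in 𝓝 w, η w' = ∑ a, g a w' • φ a w')
    (hg : ∀ a, DifferentiableAt ℝ (g a) w) (hφ : ∀ a, DifferentiableAt ℝ (φ a) w) (u v : Param) :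
    extDeriv η w ![u, v] = ∑ a, (fderiv ℝ (g a) w u * φ a w ![v] - fderiv ℝ (g a) w v * φ a w ![u]
      + g a w * extDeriv (φ a) w ![u, v]) := by
  have h1 : η =ᶠ[𝓝 w] fun w' => ∑ a, g a w' • φ a w' := hη
  have hd : DifferentiableAt ℝ (fun w' => ∑ a, g a w' • φ a w') w :=
    DifferentiableAt.fun_sum fun a _ => (hg a).smul (hφ a)
  have hφv : ∀ a v, DifferentiableAt ℝ (fun w' => φ a w' ![v]) w := fun a v =>
    (hφ a).continuousAlternatingMap_apply_const ![v]
  have key : ∀ u v, fderiv ℝ (fun w' => (∑ a, g a w' • φ a w') ![v]) w u =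
      ∑ a, (fderiv ℝ (g a) w u * φ a w ![v] + g a w * fderiv ℝ (fun w' => φ a w' ![v]) w u) := by
    intro u v
    have : (fun w' => (∑ a, g a w' • φ a w') ![v]) = fun w' => ∑ a, g a w' * φ a w' ![v] := by
      ext w'
      simp
    rw [this, fderiv_fun_sum fun a _ => (hg a).fun_mul (hφv a v)]
    simp only [sum_apply]
    refine Finset.sum_congr rfl fun a _ => ?_
    rw [fderiv_fun_mul (hg a) (hφv a v)]
    simp
    ring
  rw [h1.extDeriv_eq, extDeriv_oneForm_apply hd, key, key, ← Finset.sum_sub_distrib]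
  refine Finset.sum_congr rfl fun a _ => ?_
  rw [extDeriv_oneForm_apply (hφ a)]
  ring

/-- The functions `(c, P, Q)` coordinates for which `θ^a = dc - P dx - Q dy`. -/
def contactIdx : Fin 3 → Fin 8 × Fin 8 × Fin 8 :=
  ![(Jet2.z, Jet2.p, Jet2.q), (Jet2.p, Jet2.r, Jet2.s), (Jet2.q, Jet2.s, Jet2.t)]

theorem contactForm_eq (a : Fin 3) : contactForm a = fun j => dcoord (contactIdx a).1 -
    j (contactIdx a).2.1 • dcoord Jet2.x - j (contactIdx a).2.2 • dcoord Jet2.y := by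
  fin_cases a <;> rfl

theorem dcoord_apply (k : Fin 8) (v : Jet2) : dcoord k ![v] = v k := by
  simp [dcoord]

theorem contDiff_contactForm (a : Fin 3) : ContDiff ℝ ∞ (contactForm a) := by
  rw [contactForm_eq]
  fun_prop

theorem contactForm_apply (a : Fin 3) (j v : Jet2) : contactForm a j ![v] =
    v (contactIdx a).1 - j (contactIdx a).2.1 * v Jet2.x - j (contactIdx a).2.2 * v Jet2.y := by
  rw [contactForm_eq]
  simp [dcoord_apply]

theorem extDeriv_contactForm (a : Fin 3) (j u v : Jet2) : extDeriv (contactForm a) j ![u, v] =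
    -(u (contactIdx a).2.1 * v Jet2.x - v (contactIdx a).2.1 * u Jet2.x)
    - (u (contactIdx a).2.2 * v Jet2.y - v (contactIdx a).2.2 * u Jet2.y) := by
  rw [extDeriv_oneForm_apply ((contDiff_contactForm a).differentiable (by simp) j)]
  have key : ∀ u v : Jet2, fderiv ℝ (fun w' => contactForm a w' ![v]) j u =
      -(u (contactIdx a).2.1 * v Jet2.x) - u (contactIdx a).2.2 * v Jet2.y := by
    intro u v
    have h : HasFDerivAt (fun w' : Jet2 => contactForm a w' ![v])
        (-(v Jet2.x • ContinuousLinearMap.proj (R := ℝ) (φ := fun _ : Fin 8 => ℝ) (contactIdx a).2.1)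
        - v Jet2.y • ContinuousLinearMap.proj (R := ℝ) (φ := fun _ : Fin 8 => ℝ) (contactIdx a).2.2) j := by
      simp only [contactForm_apply]
      have h1 (k : Fin 8) := (ContinuousLinearMap.proj (R := ℝ) (φ := fun _ : Fin 8 => ℝ) k).hasFDerivAt (x := j)
      have := (((h1 (contactIdx a).2.1).mul_const (v Jet2.x)).const_sub (v (contactIdx a).1)).sub
        ((h1 (contactIdx a).2.2).mul_const (v Jet2.y))
      exact this
    rw [h.fderiv]
    simp
    ring
  rw [key, key]
  ring

section
variable {i : Param → Jet2} {S : Set Param} {w : Param}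

theorem comp_vec1 (f : Param → Jet2) (v : Param) : (f ∘ ![v]) = ![f v] := by
  ext k; fin_cases k; rfl

theorem comp_vec2 (f : Param → Jet2) (u v : Param) : (f ∘ ![u, v]) = ![f u, f v] := by
  ext k; fin_cases k <;> rfl

theorem omegaForm_apply (i : Param → Jet2) (a : Fin 3) (w v : Param) : omegaForm i a w ![v] =
    fderiv ℝ i w v (contactIdx a).1 - i w (contactIdx a).2.1 * fderiv ℝ i w v Jet2.x
      - i w (contactIdx a).2.2 * fderiv ℝ i w v Jet2.y := by
  rw [← contactForm_apply, omegaForm, ContinuousAlternatingMap.compContinuousLinearMap_apply,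
    comp_vec1]

/-- Exterior derivatives commute with pullback, so only the differential of `i` enters and its
second derivatives drop out. -/
theorem extDeriv_omegaForm (hi : ContDiffAt ℝ ∞ i w) (a : Fin 3) (u v : Param) :
    extDeriv (omegaForm i a) w ![u, v] =
    -(fderiv ℝ i w u (contactIdx a).2.1 * fderiv ℝ i w v Jet2.x
        - fderiv ℝ i w v (contactIdx a).2.1 * fderiv ℝ i w u Jet2.x)
    - (fderiv ℝ i w u (contactIdx a).2.2 * fderiv ℝ i w v Jet2.y
        - fderiv ℝ i w v (contactIdx a).2.2 * fderiv ℝ i w u Jet2.y) := by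
  rw [← extDeriv_contactForm a (i w)]
  unfold omegaForm
  rw [extDeriv_pullback ((contDiff_contactForm a).differentiable (by simp) _) hi (by simpa using ENat.LEInfty.out),
    ContinuousAlternatingMap.compContinuousLinearMap_apply, comp_vec2]

theorem differentiableAt_omegaForm (hi : ContDiffAt ℝ ∞ i w) (a : Fin 3) :
    DifferentiableAt ℝ (omegaForm i a) w := by
  have h1 : DifferentiableAt ℝ (fun w' => contactForm a (i w')) w :=
    ((contDiff_contactForm a).differentiable (by simp) _).comp w (hi.differentiableAt (by simp))
  have h2 : DifferentiableAt ℝ (fderiv ℝ i) w :=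
    (hi.fderiv_right (m := ∞) (by simp)).differentiableAt (by simp)
  exact h1.continuousAlternatingMapCompContinuousLinearMap h2

end

/-! ### Cauchy characteristics of finitely generated systems. -/

section
variable {k : ℕ} {V : Set Param} {w : Param}

theorem oneForm_ext {α β : Param [⋀^Fin 1]→L[ℝ] ℝ} (h : ∀ v, α ![v] = β ![v]) : α = β := by
  ext v
  have : v = ![v 0] := by ext k; fin_cases k; rfl
  rw [this, h]

theorem curryLeft_apply_vec (α : Param [⋀^Fin 2]→L[ℝ] ℝ) (v y : Param) :
    α.curryLeft v ![y] = α ![v, y] := rfl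

/-- `v` is annihilated by the forms `φ a` at `w`, and contracts their exterior derivatives into
their span. -/
def IsCharVector (φ : Fin k → OneForm) (w v : Param) : Prop :=
  ∀ a, φ a w ![v] = 0 ∧
    (extDeriv (φ a) w).curryLeft v ∈ Submodule.span ℝ (Set.range fun b => φ b w)

/-- Contracting dg ∧ φ with a vector killed by φ leaves dg(v)φ, which lies in the span of the
generators. Modulo that span the contraction is therefore linear over functions, which is why the
Cauchy condition can be tested on any generators. -/
theorem curryLeft_extDeriv_sum_smul {η : OneForm} {g : Fin k → Param → ℝ}
    {φ : Fin k → OneForm} (hη : ∀ᶠ w' in 𝓝 w, η w' = ∑ a, g a w' • φ a w')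
    (hg : ∀ a, DifferentiableAt ℝ (g a) w) (hφ : ∀ a, DifferentiableAt ℝ (φ a) w) {v : Param}
    (hv : ∀ a, φ a w ![v] = 0) :
    (extDeriv η w).curryLeft v =
      ∑ a, fderiv ℝ (g a) w v • φ a w + ∑ a, g a w • (extDeriv (φ a) w).curryLeft v := by
  refine oneForm_ext fun y => ?_
  rw [curryLeft_apply_vec, extDeriv_sum_smul hη hg hφ, ← Finset.sum_add_distrib]
  simp only [ContinuousAlternatingMap.sum_apply, ContinuousAlternatingMap.add_apply,
    ContinuousAlternatingMap.smul_apply, curryLeft_apply_vec, hv, smul_eq_mul]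
  exact Finset.sum_congr rfl fun a _ => by ring

theorem IsCharVector.of_sum_smul {η : OneForm} {g : Fin k → Param → ℝ}
    {φ : Fin k → OneForm} {v : Param} (h : IsCharVector φ w v)
    (hη : ∀ᶠ w' in 𝓝 w, η w' = ∑ a, g a w' • φ a w')
    (hg : ∀ a, DifferentiableAt ℝ (g a) w) (hφ : ∀ a, DifferentiableAt ℝ (φ a) w) :
    η w ![v] = 0 ∧
      (extDeriv η w).curryLeft v ∈ Submodule.span ℝ (Set.range fun b => φ b w) := by
  constructor
  · rw [hη.self_of_nhds]
    simp [fun a => (h a).1]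
  · rw [curryLeft_extDeriv_sum_smul hη hg hφ fun a => (h a).1]
    exact add_mem
      (sum_mem fun a _ => Submodule.smul_mem _ _ (Submodule.subset_span ⟨a, rfl⟩))
      (sum_mem fun a _ => Submodule.smul_mem _ _ (h a).2)

theorem mem_generated (V : Set Param) (φ : Fin k → OneForm) (a : Fin k) : φ a ∈ generated V φ :=
  ⟨fun b _ => if b = a then 1 else 0, fun _ => contDiffOn_const, fun w _ => by simp⟩

theorem valuesAt_generated (φ : Fin k → OneForm) (hw : w ∈ V) :
    valuesAt (generated V φ) w = Submodule.span ℝ (Set.range fun b => φ b w) := by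
  apply le_antisymm
  · refine Submodule.span_le.2 ?_
    rintro _ ⟨η, ⟨g, -, hη⟩, rfl⟩
    rw [hη w hw]
    exact sum_mem fun a _ => Submodule.smul_mem _ _ (Submodule.subset_span ⟨a, rfl⟩)
  · refine Submodule.span_mono ?_
    rintro _ ⟨a, rfl⟩
    exact ⟨φ a, mem_generated V φ a, rfl⟩

theorem mem_cauchyChar_generated (hV : IsOpen V) (hw : w ∈ V) {φ : Fin k → OneForm}
    (hφ : ∀ a, DifferentiableAt ℝ (φ a) w) (v : Param) :
    v ∈ cauchyChar (generated V φ) w ↔ IsCharVector φ w v := by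
  change (∀ η ∈ generated V φ, _) ↔ _
  rw [valuesAt_generated φ hw]
  refine ⟨fun h a => h _ (mem_generated V φ a), ?_⟩
  rintro h η ⟨g, hg, hη⟩
  exact h.of_sum_smul (Filter.eventually_of_mem (hV.mem_nhds hw) hη)
    (fun a => ((hg a).contDiffAt (hV.mem_nhds hw)).differentiableAt (by simp)) hφ

section
variable {φ ψ : Fin k → OneForm} {P : Fin k → Fin k → Param → ℝ}

theorem eq_sum_inv_smul (h : ∀ a, φ a w = ∑ b, P a b w • ψ b w)
    (hdet : (Matrix.of fun a b => P a b w).det ≠ 0) (b : Fin k) :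
    ψ b w = ∑ a, (Matrix.of fun a b => P a b w)⁻¹ b a • φ a w := by
  set Q := Matrix.of fun a b => P a b w
  have hQ : Q⁻¹ * Q = 1 := Matrix.nonsing_inv_mul _ (isUnit_iff_ne_zero.2 hdet)
  have : ∀ c, ∑ a, Q⁻¹ b a * Q a c = if b = c then 1 else 0 := fun c => by
    rw [← Matrix.mul_apply, hQ, Matrix.one_apply]
  simp only [h, Finset.smul_sum, smul_smul]
  rw [Finset.sum_comm]
  simp only [← Finset.sum_smul]
  have h2 : ∀ c, ∑ a, Q⁻¹ b a * P a c w = if b = c then 1 else 0 := this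
  simp [h2]

theorem span_eq_of_sum_smul (h : ∀ a, φ a w = ∑ b, P a b w • ψ b w)
    (hdet : (Matrix.of fun a b => P a b w).det ≠ 0) :
    Submodule.span ℝ (Set.range fun b => φ b w) = Submodule.span ℝ (Set.range fun b => ψ b w) := by
  apply le_antisymm <;> refine Submodule.span_le.2 ?_ <;> rintro _ ⟨a, rfl⟩
  · simp only [h]
    exact sum_mem fun a _ => Submodule.smul_mem _ _ (Submodule.subset_span ⟨a, rfl⟩)
  · simp only [eq_sum_inv_smul h hdet]
    exact sum_mem fun a _ => Submodule.smul_mem _ _ (Submodule.subset_span ⟨a, rfl⟩)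

/-- Invariance of characteristic vectors under a change of generators. -/
theorem isCharVector_iff_of_sum_smul (h : ∀ a, ∀ᶠ w' in 𝓝 w, φ a w' = ∑ b, P a b w' • ψ b w')
    (hP : ∀ a b, DifferentiableAt ℝ (P a b) w) (hψ : ∀ a, DifferentiableAt ℝ (ψ a) w)
    (hdet : (Matrix.of fun a b => P a b w).det ≠ 0) (v : Param) :
    IsCharVector φ w v ↔ IsCharVector ψ w v := by
  have h0 : ∀ a, φ a w = ∑ b, P a b w • ψ b w := fun a => (h a).self_of_nhds
  have hspan := span_eq_of_sum_smul h0 hdet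
  constructor
  · intro hφ
    have hv : ∀ b, ψ b w ![v] = 0 := fun b => by
      rw [eq_sum_inv_smul h0 hdet]
      simp [fun a => (hφ a).1]
    refine fun b => ⟨hv b, ?_⟩
    have key : ∀ a, ∑ c, P a c w • (extDeriv (ψ c) w).curryLeft v ∈
        Submodule.span ℝ (Set.range fun b => ψ b w) := fun a => by
      have h1 := (hφ a).2
      rw [hspan, curryLeft_extDeriv_sum_smul (h a) (hP a) hψ hv] at h1
      refine (Submodule.add_mem_iff_right _ ?_).1 h1
      exact sum_mem fun a _ => Submodule.smul_mem _ _ (Submodule.subset_span ⟨a, rfl⟩)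
    -- The inverse matrix recovers each contraction of dψ from the combinations in `key`. The matrix
    -- inversion lemma is reused with the contractions in the role of the generators.
    have h2 : (extDeriv (ψ b) w).curryLeft v = ∑ a, (Matrix.of fun a b => P a b w)⁻¹ b a •
        ∑ c, P a c w • (extDeriv (ψ c) w).curryLeft v :=
      eq_sum_inv_smul (ψ := fun c _ => (extDeriv (ψ c) w).curryLeft v)
        (φ := fun a _ => ∑ c, P a c w • (extDeriv (ψ c) w).curryLeft v) (fun _ => rfl) hdet b
    rw [h2]
    exact sum_mem fun a _ => Submodule.smul_mem _ _ (key a)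
  · intro hψ' a
    rw [hspan]
    exact hψ'.of_sum_smul (h a) (hP a) hψ

end

end

/-! ### Characteristic vectors of the system {ω¹, aω² + bω³}. -/

@[simp] theorem contactIdx_zero : contactIdx 0 = (Jet2.z, Jet2.p, Jet2.q) := rfl
@[simp] theorem contactIdx_one : contactIdx 1 = (Jet2.p, Jet2.r, Jet2.s) := rfl
@[simp] theorem contactIdx_two : contactIdx 2 = (Jet2.q, Jet2.s, Jet2.t) := rfl

/-- The vertical vector `b² ∂_r - a b ∂_s + a² ∂_t`. -/
def nullVec (a b : ℝ) : Jet2 := ![0, 0, 0, 0, 0, b ^ 2, -(a * b), a ^ 2]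

/-- The forms `ω¹`, `a ω² + b ω³`. -/
def charGen (i : Param → Jet2) (a b : Param → ℝ) : Fin 2 → OneForm :=
  ![omegaForm i 0, fun w => a w • omegaForm i 1 w + b w • omegaForm i 2 w]

section
variable {i : Param → Jet2} {w : Param} {a b : Param → ℝ}

theorem differentiableAt_charGen (hi : ContDiffAt ℝ ∞ i w) (ha : DifferentiableAt ℝ a w)
    (hb : DifferentiableAt ℝ b w) (k : Fin 2) : DifferentiableAt ℝ (charGen i a b k) w := by
  fin_cases k
  · exact differentiableAt_omegaForm hi 0
  · exact (ha.smul (differentiableAt_omegaForm hi 1)).add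
      (hb.smul (differentiableAt_omegaForm hi 2))

theorem extDeriv_charGen_one (hi : ContDiffAt ℝ ∞ i w) (ha : DifferentiableAt ℝ a w)
    (hb : DifferentiableAt ℝ b w) (u v : Param) :
    extDeriv (charGen i a b 1) w ![u, v] =
      fderiv ℝ a w u * omegaForm i 1 w ![v] - fderiv ℝ a w v * omegaForm i 1 w ![u]
      + a w * extDeriv (omegaForm i 1) w ![u, v]
      + (fderiv ℝ b w u * omegaForm i 2 w ![v] - fderiv ℝ b w v * omegaForm i 2 w ![u]
      + b w * extDeriv (omegaForm i 2) w ![u, v]) := by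
  rw [extDeriv_sum_smul (g := ![a, b]) (φ := ![omegaForm i 1, omegaForm i 2])]
  · simp [Fin.sum_univ_two]
  · simp [Fin.sum_univ_two, charGen]
  · intro k; fin_cases k <;> assumption
  · intro k; fin_cases k <;> exact differentiableAt_omegaForm hi _

theorem mem_span_charGen {α : Param [⋀^Fin 1]→L[ℝ] ℝ} :
    α ∈ Submodule.span ℝ (Set.range fun c => charGen i a b c w) ↔
      ∃ c d : ℝ, ∀ y, α ![y] = c * omegaForm i 0 w ![y] +
        d * (a w * omegaForm i 1 w ![y] + b w * omegaForm i 2 w ![y]) := by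
  rw [Submodule.mem_span_range_iff_exists_fun]
  constructor
  · rintro ⟨c, hc⟩
    refine ⟨c 0, c 1, fun y => ?_⟩
    rw [← hc]
    simp [Fin.sum_univ_two, charGen]
    ring
  · rintro ⟨c, d, h⟩
    refine ⟨![c, d], oneForm_ext fun y => ?_⟩
    rw [h]
    simp [Fin.sum_univ_two, charGen]
    ring

theorem vec8_ext {u v : Jet2} (h0 : u Jet2.x = v Jet2.x) (h1 : u Jet2.y = v Jet2.y)
    (h2 : u Jet2.z = v Jet2.z) (h3 : u Jet2.p = v Jet2.p) (h4 : u Jet2.q = v Jet2.q)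
    (h5 : u Jet2.r = v Jet2.r) (h6 : u Jet2.s = v Jet2.s) (h7 : u Jet2.t = v Jet2.t) : u = v := by
  ext k
  fin_cases k <;> assumption

@[simp] theorem nullVec_x (a b : ℝ) : nullVec a b Jet2.x = 0 := rfl
@[simp] theorem nullVec_y (a b : ℝ) : nullVec a b Jet2.y = 0 := rfl
@[simp] theorem nullVec_z (a b : ℝ) : nullVec a b Jet2.z = 0 := rfl
@[simp] theorem nullVec_p (a b : ℝ) : nullVec a b Jet2.p = 0 := rfl
@[simp] theorem nullVec_q (a b : ℝ) : nullVec a b Jet2.q = 0 := rfl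
@[simp] theorem nullVec_r (a b : ℝ) : nullVec a b Jet2.r = b ^ 2 := rfl
@[simp] theorem nullVec_s (a b : ℝ) : nullVec a b Jet2.s = -(a * b) := rfl
@[simp] theorem nullVec_t (a b : ℝ) : nullVec a b Jet2.t = a ^ 2 := rfl

/-- The characteristic vectors of `ω¹`, `a ω² + b ω³` are the multiples of the null vector `u`
along which the direction `a : b` is stationary. -/
theorem isCharVector_charGen_iff (hi : ContDiffAt ℝ ∞ i w) (ha : DifferentiableAt ℝ a w)
    (hb : DifferentiableAt ℝ b w) (hinj : Function.Injective (fderiv ℝ i w))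
    (hlift : ∀ x y z p q : ℝ, ∃ v, fderiv ℝ i w v Jet2.x = x ∧ fderiv ℝ i w v Jet2.y = y ∧
      fderiv ℝ i w v Jet2.z = z ∧ fderiv ℝ i w v Jet2.p = p ∧ fderiv ℝ i w v Jet2.q = q)
    {u u' : Param} {a' b' : ℝ} (hu : fderiv ℝ i w u = nullVec (a w) (b w))
    (hu' : fderiv ℝ i w u' = nullVec a' b') (hab : a w * b' - a' * b w ≠ 0) (v : Param) :
    IsCharVector (charGen i a b) w v ↔
      (∃ c : ℝ, v = c • u) ∧ b w * fderiv ℝ a w v - a w * fderiv ℝ b w v = 0 := by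
  simp only [IsCharVector, mem_span_charGen, curryLeft_apply_vec, Fin.forall_fin_two,
    extDeriv_charGen_one hi ha hb]
  have e0 : charGen i a b 0 = omegaForm i 0 := rfl
  have e1 : ∀ y, charGen i a b 1 w ![y] = a w * omegaForm i 1 w ![y] + b w * omegaForm i 2 w ![y] :=
    fun y => by simp [charGen]
  simp only [e0, e1, extDeriv_omegaForm hi, omegaForm_apply, contactIdx_zero, contactIdx_one,
    contactIdx_two]
  set X := fderiv ℝ i w
  set j := i w
  have hne : a w ≠ 0 ∨ b w ≠ 0 := by
    by_contra! h
    simp [h.1, h.2] at hab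
  constructor
  · rintro ⟨⟨h1, c, d, h2⟩, h3, c', d', h4⟩
    -- Test vectors on which both generators vanish, so that the unknown span coefficients
    -- disappear. `y1` and `y2` lift the total derivatives and kill all three ω's, while `y3` kills
    -- ω¹ and aω² + bω³. The vertical vector `u'` serves as a fourth.
    obtain ⟨y1, e11, e12, e13, e14, e15⟩ := hlift 1 0 (j Jet2.p) (j Jet2.r) (j Jet2.s)
    obtain ⟨y2, e21, e22, e23, e24, e25⟩ := hlift 0 1 (j Jet2.q) (j Jet2.s) (j Jet2.t)
    obtain ⟨y3, e31, e32, e33, e34, e35⟩ := hlift 0 0 0 (b w) (-a w)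
    have p1 := h2 y1
    have p2 := h2 y2
    have p3 := h2 y3
    have q1 := h4 y1
    have q2 := h4 y2
    have q3 := h4 y3
    have q4 := h4 u'
    simp only [e11, e12, e13, e14, e15, e21, e22, e23, e24, e25, e31, e32, e33, e34, e35, hu',
      nullVec_x, nullVec_y, nullVec_z, nullVec_p, nullVec_q, nullVec_r, nullVec_s, nullVec_t]
      at p1 p2 p3 q1 q2 q3 q4
    clear h2 h4
    have p1' : X v Jet2.p = j Jet2.r * X v Jet2.x + j Jet2.s * X v Jet2.y := by
      linear_combination -p1
    have p2' : X v Jet2.q = j Jet2.s * X v Jet2.x + j Jet2.t * X v Jet2.y := by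
      linear_combination -p2
    have p3' : b w * X v Jet2.x = a w * X v Jet2.y := by linear_combination p3
    rw [p1', p2'] at q4
    -- The pairing with `u'` factors as (ab' - a'b)(b'x - a'y). Together with `p3'` this gives two
    -- independent equations for the `x` and `y` components of `v`, which forces `v` to be vertical.
    have q4' : b' * X v Jet2.x = a' * X v Jet2.y := by
      apply mul_left_cancel₀ hab
      linear_combination q4
    have hx : X v Jet2.x = 0 := by
      apply mul_left_cancel₀ hab
      linear_combination a w * q4' - a' * p3'
    have hy : X v Jet2.y = 0 := by
      apply mul_left_cancel₀ hab
      linear_combination b w * q4' - b' * p3'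
    have hp : X v Jet2.p = 0 := by
      simp only [hx, hy] at p1
      linarith
    have hq : X v Jet2.q = 0 := by
      simp only [hx, hy] at p2
      linarith
    have hz : X v Jet2.z = 0 := by
      simp only [hx, hy] at h1
      linarith
    simp only [hx, hy, hp, hq] at q1 q2 q3
    have hA : a w * X v Jet2.r + b w * X v Jet2.s = 0 := by linarith
    have hB : a w * X v Jet2.s + b w * X v Jet2.t = 0 := by linarith
    refine ⟨?_, by linarith⟩
    have hpos : a w ^ 2 + b w ^ 2 ≠ 0 := by
      rcases hne with h | h <;> positivity
    -- The relations `hA`, `hB` make (r,s,t) proportional to (b², -ab, a²). The factor is found by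
    -- comparing r + t with a² + b².
    refine ⟨(X v Jet2.r + X v Jet2.t) / (a w ^ 2 + b w ^ 2), hinj ?_⟩
    rw [map_smul, hu]
    refine vec8_ext ?_ ?_ ?_ ?_ ?_ ?_ ?_ ?_ <;>
      simp only [Pi.smul_apply, smul_eq_mul, nullVec_x, nullVec_y, nullVec_z, nullVec_p, nullVec_q,
        nullVec_r, nullVec_s, nullVec_t, hx, hy, hz, hp, hq, mul_zero] <;>
      field_simp
    · linear_combination a w * hA - b w * hB
    · linear_combination b w * hA + a w * hB
    · linear_combination b w * hB - a w * hA
  · rintro ⟨⟨c, rfl⟩, h⟩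
    simp only [map_smul, hu, Pi.smul_apply, smul_eq_mul, nullVec_x, nullVec_y, nullVec_z, nullVec_p,
      nullVec_q, nullVec_r, nullVec_s, nullVec_t] at h ⊢
    -- For vertical `v` along N(a,b), contracting the derivative of the second generator leaves
    -- da(v)ω² + db(v)ω³. By stationarity (da(v), db(v)) is a multiple of (a,b), and the coefficient
    -- is its orthogonal projection.
    refine ⟨⟨by ring, 0, 0, fun y => by ring⟩, by ring, 0,
      (a w * (c * fderiv ℝ a w u) + b w * (c * fderiv ℝ b w u)) / (a w ^ 2 + b w ^ 2), fun y => ?_⟩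
    have hpos : a w ^ 2 + b w ^ 2 ≠ 0 := by
      rcases hne with h | h <;> positivity
    field_simp
    linear_combination
      (b w * (X y Jet2.p - j Jet2.r * X y Jet2.x - j Jet2.s * X y Jet2.y)
        - a w * (X y Jet2.q - j Jet2.s * X y Jet2.x - j Jet2.t * X y Jet2.y)) * h
end

/-! ### The Hessian of `F` in the null directions. -/

section
variable {F : Jet2 → ℝ} {j : Jet2}

theorem fderiv_apply_eq_sum_pd (F : Jet2 → ℝ) (j v : Jet2) :
    fderiv ℝ F j v = ∑ k, v k * pd k F j := by
  conv_lhs => rw [pi_eq_sum_univ' v]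
  simp only [map_sum, map_smul, smul_eq_mul, pd]

theorem contDiffAt_pd (hF : ContDiffAt ℝ ∞ F j) (k : Fin 8) : ContDiffAt ℝ ∞ (pd k F) j :=
  (hF.fderiv_right (m := ∞) (by simp)).clm_apply contDiffAt_const

theorem pd_comm (hF : ContDiffAt ℝ ∞ F j) (k l : Fin 8) : pd k (pd l F) j = pd l (pd k F) j := by
  have hd : DifferentiableAt ℝ (fderiv ℝ F) j :=
    (hF.fderiv_right (m := ∞) (by simp)).differentiableAt (by simp)
  have h : ∀ k l, pd k (pd l F) j =
      fderiv ℝ (fderiv ℝ F) j (Pi.single k 1) (Pi.single l 1) := by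
    intro k l
    unfold pd
    rw [fderiv_clm_apply hd (differentiableAt_const _)]
    simp
  rw [h, h]
  exact hF.isSymmSndFDerivAt (by simpa using ENat.LEInfty.out) _ _

/-- The restriction of the Hessian of `F` to the fibre direction `nullVec a b`. -/
def nullHess (F : Jet2 → ℝ) (j : Jet2) (a b : ℝ) : ℝ :=
  a ^ 2 * fderiv ℝ (pd Jet2.t F) j (nullVec a b) - a * b * fderiv ℝ (pd Jet2.s F) j (nullVec a b)
    + b ^ 2 * fderiv ℝ (pd Jet2.r F) j (nullVec a b)

theorem fderiv_nullVec (G : Jet2 → ℝ) (j : Jet2) (a b : ℝ) : fderiv ℝ G j (nullVec a b) =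
    b ^ 2 * pd Jet2.r G j - a * b * pd Jet2.s G j + a ^ 2 * pd Jet2.t G j := by
  rw [fderiv_apply_eq_sum_pd]
  simp [Fin.sum_univ_eight, nullVec]
  ring

/-- The characteristic quadratic form `F_t a² - F_s a b + F_r b²`. -/
def charQuad (F : Jet2 → ℝ) (j : Jet2) (a b : ℝ) : ℝ :=
  pd Jet2.t F j * a ^ 2 - pd Jet2.s F j * (a * b) + pd Jet2.r F j * b ^ 2

/-- Along a field of null directions `(A, B)` of the characteristic quadratic form, the direction
`A : B` is stationary along `nullVec A B` iff the Hessian vanishes there. -/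
theorem stationary_iff_nullHess (hF : ContDiffAt ℝ ∞ F j) (hd : discr F j < 0) {A B : Jet2 → ℝ}
    (hA : DifferentiableAt ℝ A j) (hB : DifferentiableAt ℝ B j) (hne : A j ≠ 0 ∨ B j ≠ 0)
    (hq : ∀ᶠ j' in 𝓝 j, charQuad F j' (A j') (B j') = 0) :
    B j * fderiv ℝ A j (nullVec (A j) (B j)) - A j * fderiv ℝ B j (nullVec (A j) (B j)) = 0 ↔
      nullHess F j (A j) (B j) = 0 := by
  have hdt := ((contDiffAt_pd hF Jet2.t).differentiableAt (by simp)).hasFDerivAt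
  have hds := ((contDiffAt_pd hF Jet2.s).differentiableAt (by simp)).hasFDerivAt
  have hdr := ((contDiffAt_pd hF Jet2.r).differentiableAt (by simp)).hasFDerivAt
  have hA' := hA.hasFDerivAt
  have hB' := hB.hasFDerivAt
  have h1 := ((hdt.mul (hA'.pow 2)).sub (hds.mul (hA'.mul hB'))).add (hdr.mul (hB'.pow 2))
  have h0 : HasFDerivAt (fun j' => charQuad F j' (A j') (B j')) (0 : Jet2 →L[ℝ] ℝ) j :=
    (hasFDerivAt_const (0 : ℝ) j).congr_of_eventuallyEq hq
  have h2 := DFunLike.congr_fun (h1.unique h0) (nullVec (A j) (B j))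
  have h3 : charQuad F j (A j) (B j) = 0 := hq.self_of_nhds
  simp only [add_apply, sub_apply,
    smul_apply, smul_eq_mul, zero_apply, nsmul_eq_mul, Pi.mul_apply] at h2
  unfold charQuad at h3
  unfold discr at hd
  unfold nullHess
  set U := nullVec (A j) (B j)
  set DA := fderiv ℝ A j U
  set DB := fderiv ℝ B j U
  set Ft := pd Jet2.t F j
  set Fs := pd Jet2.s F j
  set Fr := pd Jet2.r F j
  set H := A j ^ 2 * fderiv ℝ (pd Jet2.t F) j U - A j * B j * fderiv ℝ (pd Jet2.s F) j U
    + B j ^ 2 * fderiv ℝ (pd Jet2.r F) j U with hH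
  -- The identity `charQuad = 0` differentiated along N(A,B): the coefficients contribute the
  -- Hessian term H, the arguments the gradient of the quadratic form. `h5` is Euler's relation for
  -- that form, and with it both A·H and B·H become multiples of B·DA - A·DB.
  have h4 : H + (2 * Ft * A j - Fs * B j) * DA + (2 * Fr * B j - Fs * A j) * DB = 0 := by
    rw [← h2, hH]
    push_cast
    ring
  have h5 : (2 * Ft * A j - Fs * B j) * A j + (2 * Fr * B j - Fs * A j) * B j = 0 := by
    linear_combination 2 * h3
  have h6 : B j * H = -(2 * Ft * A j - Fs * B j) * (B j * DA - A j * DB) := by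
    linear_combination B j * h4 - DB * h5
  have h7 : A j * H = (2 * Fr * B j - Fs * A j) * (B j * DA - A j * DB) := by
    linear_combination A j * h4 - DA * h5
  constructor
  · intro h
    rw [h, mul_zero] at h6 h7
    rcases hne with hne | hne
    · exact (mul_eq_zero.1 h7).resolve_left hne
    · exact (mul_eq_zero.1 h6).resolve_left hne
  · intro h
    rw [h, mul_zero] at h6 h7
    by_contra hW
    have h8 : -(2 * Ft * A j - Fs * B j) = 0 := (mul_eq_zero.1 h6.symm).resolve_right hW
    have h9 : 2 * Fr * B j - Fs * A j = 0 := (mul_eq_zero.1 h7.symm).resolve_right hW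
    -- The gradient of a nondegenerate quadratic form vanishes only at the origin.
    have hd' : 4 * (Fr * Ft - Fs ^ 2 / 4) ≠ 0 := fun h' => by linarith
    rcases hne with hne | hne
    · refine mul_ne_zero hd' hne ?_
      linear_combination -2 * Fr * h8 + Fs * h9
    · refine mul_ne_zero hd' hne ?_
      linear_combination -Fs * h8 + 2 * Ft * h9

end

/-! ### From characteristic vectors to the class. -/

section
variable {i : Param → Jet2} {w : Param} {V : Set Param}

/-- The Cauchy characteristic space lies in the line ℝu and is all of it or zero, so its annihilator
in dimension 7 has dimension 6 or 7. Arbitrary generators `φ` are allowed because a characteristic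
pair comes with no preferred ones. -/
theorem classAt_of_charGen (hV : IsOpen V) (hw : w ∈ V) (hi : ContDiffAt ℝ ∞ i w)
    {a b : Param → ℝ} (ha : DifferentiableAt ℝ a w)
    (hb : DifferentiableAt ℝ b w) (hinj : Function.Injective (fderiv ℝ i w))
    (hlift : ∀ x y z p q : ℝ, ∃ v, fderiv ℝ i w v Jet2.x = x ∧ fderiv ℝ i w v Jet2.y = y ∧
      fderiv ℝ i w v Jet2.z = z ∧ fderiv ℝ i w v Jet2.p = p ∧ fderiv ℝ i w v Jet2.q = q)
    {u u' : Param} {a' b' : ℝ} (hu : fderiv ℝ i w u = nullVec (a w) (b w))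
    (hu' : fderiv ℝ i w u' = nullVec a' b') (hab : a w * b' - a' * b w ≠ 0)
    {φ : Fin 2 → OneForm} {P : Fin 2 → Fin 2 → Param → ℝ}
    (h : ∀ c, ∀ᶠ w' in 𝓝 w, φ c w' = ∑ d, P c d w' • charGen i a b d w')
    (hφ : ∀ c, DifferentiableAt ℝ (φ c) w)
    (hP : ∀ c d, DifferentiableAt ℝ (P c d) w)
    (hdet : (Matrix.of fun c d => P c d w).det ≠ 0) :
    (b w * fderiv ℝ a w u - a w * fderiv ℝ b w u = 0 → classAt (generated V φ) w = 6) ∧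
    (b w * fderiv ℝ a w u - a w * fderiv ℝ b w u ≠ 0 → classAt (generated V φ) w = 7) := by
  have key : ∀ v, v ∈ cauchyChar (generated V φ) w ↔
      (∃ c : ℝ, v = c • u) ∧ b w * fderiv ℝ a w v - a w * fderiv ℝ b w v = 0 := fun v => by
    rw [mem_cauchyChar_generated hV hw hφ,
      isCharVector_iff_of_sum_smul h hP (differentiableAt_charGen hi ha hb) hdet,
      isCharVector_charGen_iff hi ha hb hinj hlift hu hu' hab]
  have hu0 : u ≠ 0 := by
    rintro rfl
    rw [map_zero] at hu
    have h1 := congrFun hu Jet2.r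
    have h2 := congrFun hu Jet2.t
    simp at h1 h2
    rw [pow_eq_zero_iff two_ne_zero |>.1 h1.symm, pow_eq_zero_iff two_ne_zero |>.1 h2.symm] at hab
    simp at hab
  have hdim := Subspace.finrank_add_finrank_dualAnnihilator_eq (cauchyChar (generated V φ) w)
  have h7 : Module.finrank ℝ Param = 7 := by simp
  constructor
  · intro h0
    have : cauchyChar (generated V φ) w = Submodule.span ℝ {u} := by
      ext v
      rw [key, Submodule.mem_span_singleton]
      constructor
      · rintro ⟨⟨c, rfl⟩, -⟩
        exact ⟨c, rfl⟩
      · rintro ⟨c, rfl⟩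
        refine ⟨⟨c, rfl⟩, ?_⟩
        simp only [map_smul, smul_eq_mul]
        linear_combination c * h0
    rw [classAt]
    rw [this, finrank_span_singleton hu0, h7] at hdim
    rw [this]
    omega
  · intro h0
    have : cauchyChar (generated V φ) w = ⊥ := by
      refine (Submodule.eq_bot_iff _).2 fun v hv => ?_
      obtain ⟨⟨c, rfl⟩, h1⟩ := (key v).1 hv
      simp only [map_smul, smul_eq_mul] at h1
      have : c * (b w * fderiv ℝ a w u - a w * fderiv ℝ b w u) = 0 := by linear_combination h1
      rw [(mul_eq_zero.1 this).resolve_right h0, zero_smul]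
    rw [classAt]
    rw [this, finrank_bot, h7] at hdim
    rw [this]
    omega

end

/-! ### The pairing in adapted coordinates. -/

theorem wedgeOne_apply_of_eq_zero {n : ℕ} (σ : Param [⋀^Fin 1]→L[ℝ] ℝ)
    (α : Param [⋀^Fin n]→ₗ[ℝ] ℝ) (u : Param) (v : Fin n → Param) (h : ∀ k, σ ![v k] = 0) :
    wedgeOne σ α (Matrix.vecCons u v) = σ ![u] * α v := by
  have e : ∀ y, (ContinuousAlternatingMap.ofSubsingleton ℝ Param ℝ (0 : Fin 1)).symm σ y = σ ![y] :=
    eval_ofSubsingleton σ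
  rw [wedgeOne, AlternatingMap.alternatizeUncurryFin_apply, Fin.sum_univ_succ]
  simp only [LinearMap.smulRight_apply, ContinuousLinearMap.coe_coe, e, Matrix.cons_val_succ, h,
    Matrix.cons_val_zero, Fin.val_zero, pow_zero, one_smul, zero_smul,
    AlternatingMap.smul_apply, smul_eq_mul, AlternatingMap.zero_apply]
  simp

section
variable {i : Param → Jet2} {w : Param}

/-- A 7-form on ℝ⁷ vanishes iff it vanishes on one basis. The basis used consists of lifts of ∂_z,
∂_p, ∂_q, of the two total derivatives, and of the two null vectors. The three ω's are triangular on
it, so they peel off one at a time and leave dη ∧ dζ on the last four vectors, which span the common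
kernel of the ω's. -/
theorem pairing_eq_zero_iff (hi : ContDiffAt ℝ ∞ i w)
    (hlift : ∀ x y z p q : ℝ, ∃ v, fderiv ℝ i w v Jet2.x = x ∧ fderiv ℝ i w v Jet2.y = y ∧
      fderiv ℝ i w v Jet2.z = z ∧ fderiv ℝ i w v Jet2.p = p ∧ fderiv ℝ i w v Jet2.q = q)
    {u₁ u₂ : Param} {a₁ b₁ a₂ b₂ : ℝ} (hu₁ : fderiv ℝ i w u₁ = nullVec a₁ b₁)
    (hu₂ : fderiv ℝ i w u₂ = nullVec a₂ b₂) (hab : a₁ * b₂ - a₂ * b₁ ≠ 0)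
    {η ζ : OneForm} {g h : Fin 3 → Param → ℝ}
    (hη : ∀ᶠ w' in 𝓝 w, η w' = ∑ a, g a w' • omegaForm i a w')
    (hζ : ∀ᶠ w' in 𝓝 w, ζ w' = ∑ a, h a w' • omegaForm i a w')
    (hg : ∀ a, DifferentiableAt ℝ (g a) w) (hh : ∀ a, DifferentiableAt ℝ (h a) w) :
    pairing i η ζ w = 0 ↔
      (g 1 w * b₁ - g 2 w * a₁) * (h 1 w * b₂ - h 2 w * a₂) +
        (g 1 w * b₂ - g 2 w * a₂) * (h 1 w * b₁ - h 2 w * a₁) = 0 := by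
  have dη := extDeriv_sum_smul hη hg (differentiableAt_omegaForm hi)
  have dζ := extDeriv_sum_smul hζ hh (differentiableAt_omegaForm hi)
  simp only [Fin.sum_univ_three, extDeriv_omegaForm hi, omegaForm_apply, contactIdx_zero,
    contactIdx_one, contactIdx_two] at dη dζ
  have hom := omegaForm_apply i
  obtain ⟨e1, e11, e12, e13, e14, e15⟩ := hlift 0 0 1 0 0
  obtain ⟨e2, e21, e22, e23, e24, e25⟩ := hlift 0 0 0 1 0
  obtain ⟨e3, e31, e32, e33, e34, e35⟩ := hlift 0 0 0 0 1
  obtain ⟨e4, e41, e42, e43, e44, e45⟩ := hlift 1 0 (i w Jet2.p) (i w Jet2.r) (i w Jet2.s)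
  obtain ⟨e5, e51, e52, e53, e54, e55⟩ := hlift 0 1 (i w Jet2.q) (i w Jet2.s) (i w Jet2.t)
  have hval : pairing i η ζ w ![e1, e2, e3, e4, e5, u₁, u₂] = (a₂ * b₁ - a₁ * b₂) *
      ((g 1 w * b₁ - g 2 w * a₁) * (h 1 w * b₂ - h 2 w * a₂) +
        (g 1 w * b₂ - g 2 w * a₂) * (h 1 w * b₁ - h 2 w * a₁)) := by
    unfold pairing
    rw [wedgeOne_apply_of_eq_zero, wedgeOne_apply_of_eq_zero, wedgeOne_apply_of_eq_zero]
    · simp only [hom, contactIdx_zero, contactIdx_one, contactIdx_two, e11, e12, e13, e21, e22, e24,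
        e31, e32, e35]
      change _ * (_ * (_ * (extDeriv η w ![e4, e5] * extDeriv ζ w ![u₁, u₂]
        - extDeriv η w ![e4, u₁] * extDeriv ζ w ![e5, u₂]
        + extDeriv η w ![e4, u₂] * extDeriv ζ w ![e5, u₁]
        + extDeriv η w ![e5, u₁] * extDeriv ζ w ![e4, u₂]
        - extDeriv η w ![e5, u₂] * extDeriv ζ w ![e4, u₁]
        + extDeriv η w ![u₁, u₂] * extDeriv ζ w ![e4, e5]))) = _
      simp only [dη, dζ, hu₁, hu₂, e41, e42, e43, e44, e45, e51, e52, e53, e54, e55, nullVec_x,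
        nullVec_y, nullVec_z, nullVec_p, nullVec_q, nullVec_r, nullVec_s, nullVec_t]
      ring
    all_goals
      intro k
      fin_cases k <;> simp [hom, hu₁, hu₂, e21, e22, e23, e31, e32, e33, e34, e41, e42, e43, e44, e45, e51, e52, e53, e54, e55]
  have hab' : a₂ * b₁ - a₁ * b₂ ≠ 0 := fun h => hab (by linarith)
  have hli : LinearIndependent ℝ ![e1, e2, e3, e4, e5, u₁, u₂] := by
    rw [Fintype.linearIndependent_iff]
    intro c hc
    have hX := congrArg (fderiv ℝ i w) hc
    simp only [map_sum, map_smul, map_zero] at hX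
    have hk := fun k => congrFun hX k
    simp only [Finset.sum_apply, Fin.sum_univ_seven, Pi.smul_apply, smul_eq_mul, Pi.zero_apply]
      at hk
    have k0 := hk Jet2.x
    have k1 := hk Jet2.y
    have k2 := hk Jet2.z
    have k3 := hk Jet2.p
    have k4 := hk Jet2.q
    have k5 := hk Jet2.r
    have k6 := hk Jet2.s
    have k7 := hk Jet2.t
    clear hk
    simp [hu₁, hu₂, e11, e12, e13, e14, e15, e21, e22, e23, e24, e25, e31, e32, e33, e34,
        e35, e41, e42, e43, e44, e45, e51, e52, e53, e54, e55] at k0 k1 k2 k3 k4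
    simp [k0, k1] at k2 k3 k4
    simp [hu₁, hu₂, k0, k1, k2, k3, k4] at k5 k6 k7
    -- N(a₁,b₁) and N(a₂,b₂) are independent: the functional b₂²t + 2a₂b₂s + a₂²r kills the second
    -- and takes the value (a₁b₂ - a₂b₁)² on the first.
    have k8 : c 5 = 0 := by
      apply mul_left_cancel₀ hab
      apply mul_left_cancel₀ hab
      linear_combination b₂ ^ 2 * k7 + 2 * a₂ * b₂ * k6 + a₂ ^ 2 * k5
    have k9 : c 6 = 0 := by
      apply mul_left_cancel₀ hab
      apply mul_left_cancel₀ hab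
      linear_combination b₁ ^ 2 * k7 + 2 * a₁ * b₁ * k6 + a₁ ^ 2 * k5
    intro k
    fin_cases k <;> assumption
  let e := basisOfLinearIndependentOfCardEqFinrank hli (by simp)
  have he : ⇑e = ![e1, e2, e3, e4, e5, u₁, u₂] := by simp [e]
  constructor
  · intro h0
    rw [h0] at hval
    exact (mul_eq_zero.1 hval.symm).resolve_left hab'
  · intro h0
    rw [AlternatingMap.eq_smul_basis_det e (pairing i η ζ w), he, hval, h0, mul_zero, zero_smul]

end

/-! ### Classification of the isotropic rank-two subsystems. -/

/-- At `w`, the immersion `i` is transverse to the fibres of `J² → J¹`, and `(a₁, b₁)`, `(a₂, b₂)`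
are smooth independent fields whose null vectors are tangent to `i`. -/
structure CharFrame (i : Param → Jet2) (a₁ b₁ a₂ b₂ : Param → ℝ) (w : Param) : Prop where
  smooth : ContDiffAt ℝ ∞ i w
  injective : Function.Injective (fderiv ℝ i w)
  lift : ∀ x y z p q : ℝ, ∃ v, fderiv ℝ i w v Jet2.x = x ∧ fderiv ℝ i w v Jet2.y = y ∧
      fderiv ℝ i w v Jet2.z = z ∧ fderiv ℝ i w v Jet2.p = p ∧ fderiv ℝ i w v Jet2.q = q
  smooth_a₁ : ContDiffAt ℝ ∞ a₁ w
  smooth_b₁ : ContDiffAt ℝ ∞ b₁ w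
  smooth_a₂ : ContDiffAt ℝ ∞ a₂ w
  smooth_b₂ : ContDiffAt ℝ ∞ b₂ w
  tangent₁ : ∃ u, fderiv ℝ i w u = nullVec (a₁ w) (b₁ w)
  tangent₂ : ∃ u, fderiv ℝ i w u = nullVec (a₂ w) (b₂ w)
  indep : a₁ w * b₂ w - a₂ w * b₁ w ≠ 0

/-- Near `w`, the system `M` is generated by `ω¹` and `a ω² + b ω³`. -/
def IsBranch (i : Param → Jet2) (V : Set Param) (M : Set OneForm) (w : Param)
    (a b : Param → ℝ) : Prop :=
  ∃ (φ : Fin 2 → OneForm) (P : Fin 2 → Fin 2 → Param → ℝ), M = generated V φ ∧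
    (∀ c, DifferentiableAt ℝ (φ c) w) ∧
    (∀ c, ∀ᶠ w' in 𝓝 w, φ c w' = ∑ d, P c d w' • charGen i a b d w') ∧
    (∀ c d, DifferentiableAt ℝ (P c d) w) ∧ (Matrix.of fun c d => P c d w).det ≠ 0

section
variable {i : Param → Jet2} {w : Param} {V : Set Param} {M : Set OneForm}
  {a₁ b₁ a₂ b₂ : Param → ℝ}

theorem CharFrame.symm (h : CharFrame i a₁ b₁ a₂ b₂ w) : CharFrame i a₂ b₂ a₁ b₁ w where
  smooth := h.smooth
  injective := h.injective
  lift := h.lift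
  smooth_a₁ := h.smooth_a₂
  smooth_b₁ := h.smooth_b₂
  smooth_a₂ := h.smooth_a₁
  smooth_b₂ := h.smooth_b₁
  tangent₁ := h.tangent₂
  tangent₂ := h.tangent₁
  indep := fun h' => h.indep (by linarith)

theorem CharFrame.sq_add_sq_ne_zero (h : CharFrame i a₁ b₁ a₂ b₂ w) : a₁ w ^ 2 + b₁ w ^ 2 ≠ 0 := by
  intro h0
  have ha : a₁ w = 0 := by nlinarith [sq_nonneg (a₁ w), sq_nonneg (b₁ w)]
  have hb : b₁ w = 0 := by nlinarith [sq_nonneg (a₁ w), sq_nonneg (b₁ w)]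
  exact h.indep (by rw [ha, hb]; ring)

theorem IsBranch.valuesAt_eq {a b : Param → ℝ} (h : IsBranch i V M w a b) (hw : w ∈ V) :
    valuesAt M w = Submodule.span ℝ (Set.range fun c => charGen i a b c w) := by
  obtain ⟨φ, P, rfl, -, h1, -, h2⟩ := h
  rw [valuesAt_generated φ hw, span_eq_of_sum_smul (fun a => (h1 a).self_of_nhds) h2]

/-- Isotropy of a single generator says that a product of two linear forms vanishes. If the second
factor is nonzero at `w`, it stays so nearby and the first must vanish there. Pairing that generator
with the others then kills their first factor too, so all of them lie in the span of ω¹ and a₁ω² +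
b₁ω³. -/
theorem isBranch_of_ne_zero {φ : Fin 2 → OneForm} {g : Fin 2 → Fin 3 → Param → ℝ}
    (hf : ∀ᶠ w' in 𝓝 w, CharFrame i a₁ b₁ a₂ b₂ w')
    (hφ : ∀ c, ∀ᶠ w' in 𝓝 w, φ c w' = ∑ a, g c a w' • omegaForm i a w')
    (hg : ∀ c a, ContDiffAt ℝ ∞ (g c a) w) (hli : LinearIndependent ℝ fun c => φ c w)
    (hiso : ∀ c d, ∀ᶠ w' in 𝓝 w,
      (g c 1 w' * b₁ w' - g c 2 w' * a₁ w') * (g d 1 w' * b₂ w' - g d 2 w' * a₂ w') +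
        (g c 1 w' * b₂ w' - g c 2 w' * a₂ w') * (g d 1 w' * b₁ w' - g d 2 w' * a₁ w') = 0)
    {c : Fin 2} (hc : g c 1 w * b₂ w - g c 2 w * a₂ w ≠ 0) :
    IsBranch i V (generated V φ) w a₁ b₁ := by
  have hfw := hf.self_of_nhds
  have hc' : ∀ᶠ w' in 𝓝 w, g c 1 w' * b₂ w' - g c 2 w' * a₂ w' ≠ 0 := by
    have : ContinuousAt (fun w' => g c 1 w' * b₂ w' - g c 2 w' * a₂ w') w :=
      ((hg c 1).continuousAt.mul hfw.smooth_b₂.continuousAt).sub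
        ((hg c 2).continuousAt.mul hfw.smooth_a₂.continuousAt)
    exact this.eventually_ne hc
  have hz : ∀ d, ∀ᶠ w' in 𝓝 w, g d 1 w' * b₁ w' - g d 2 w' * a₁ w' = 0 := by
    intro d
    filter_upwards [hc', hiso c c, hiso c d] with w' h1 h2 h3
    have h4 : g c 1 w' * b₁ w' - g c 2 w' * a₁ w' = 0 := by
      refine (mul_eq_zero.1 (?_ : _ * (g c 1 w' * b₂ w' - g c 2 w' * a₂ w') = 0)).resolve_right h1
      linear_combination h2 / 2
    rw [h4, zero_mul, zero_add] at h3
    exact (mul_eq_zero.1 h3).resolve_left h1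
  -- The pair of ω², ω³ coefficients is parallel to (a₁,b₁), and orthogonal projection gives the
  -- factor as a differentiable function without a case split on which of a₁, b₁ is nonzero.
  let P : Fin 2 → Fin 2 → Param → ℝ := fun d => ![g d 0,
    fun w' => (g d 1 w' * a₁ w' + g d 2 w' * b₁ w') / (a₁ w' ^ 2 + b₁ w' ^ 2)]
  have hP : ∀ d, ∀ᶠ w' in 𝓝 w, φ d w' = ∑ e, P d e w' • charGen i a₁ b₁ e w' := by
    intro d
    filter_upwards [hf, hφ d, hz d] with w' h1 h2 h3
    have h4 := h1.sq_add_sq_ne_zero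
    have hP1 : P d 1 w' = (g d 1 w' * a₁ w' + g d 2 w' * b₁ w') / (a₁ w' ^ 2 + b₁ w' ^ 2) := rfl
    have h5 : g d 1 w' = P d 1 w' * a₁ w' := by
      rw [hP1]
      field_simp
      linear_combination b₁ w' * h3
    have h6 : g d 2 w' = P d 1 w' * b₁ w' := by
      rw [hP1]
      field_simp
      linear_combination -a₁ w' * h3
    rw [h2, Fin.sum_univ_two, Fin.sum_univ_three, h5, h6]
    simp only [charGen, Matrix.cons_val_zero, Matrix.cons_val_one, smul_add, smul_smul, P]
    rw [add_assoc]
  refine ⟨φ, P, rfl, ?_, hP, ?_, ?_⟩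
  · intro d
    have h1 : φ d =ᶠ[𝓝 w] fun w' => ∑ a, g d a w' • omegaForm i a w' := hφ d
    refine DifferentiableAt.congr_of_eventuallyEq ?_ h1
    exact DifferentiableAt.fun_sum fun a _ => ((hg d a).differentiableAt (by simp)).smul
      (differentiableAt_omegaForm hfw.smooth a)
  · intro d e
    fin_cases e
    · exact (hg d 0).differentiableAt (by simp)
    · have ha := hfw.smooth_a₁.differentiableAt (by simp)
      have hb := hfw.smooth_b₁.differentiableAt (by simp)
      have h1 := (hg d 1).differentiableAt (by simp)
      have h2 := (hg d 2).differentiableAt (by simp)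
      have h3 := hfw.sq_add_sq_ne_zero
      change DifferentiableAt ℝ
        (fun w' => (g d 1 w' * a₁ w' + g d 2 w' * b₁ w') / (a₁ w' ^ 2 + b₁ w' ^ 2)) w
      fun_prop (disch := assumption)
  · intro hdet
    obtain ⟨v, hv, hv'⟩ := Matrix.exists_vecMul_eq_zero_iff.2 hdet
    rw [Fintype.linearIndependent_iff] at hli
    refine hv (funext (hli v ?_))
    have h1 := fun d => (hP d).self_of_nhds
    simp only [h1, Finset.smul_sum, smul_smul]
    rw [Finset.sum_comm]
    refine Finset.sum_eq_zero fun e _ => ?_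
    rw [← Finset.sum_smul]
    have h2 : ∑ d, v d * P d e w = 0 := congrFun hv' e
    rw [h2, zero_smul]

theorem IsCharacteristicSystem.isBranch (hV : IsOpen V) (hw : w ∈ V)
    (hf : ∀ᶠ w' in 𝓝 w, CharFrame i a₁ b₁ a₂ b₂ w') (hM : IsCharacteristicSystem i V M) :
    IsBranch i V M w a₁ b₁ ∨ IsBranch i V M w a₂ b₂ := by
  obtain ⟨⟨φ, rfl, hφ, hli⟩, hiso⟩ := hM
  choose g hg hgφ using hφ
  have hnear : ∀ᶠ w' in 𝓝 w, w' ∈ V := hV.mem_nhds hw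
  have hφ' : ∀ w' ∈ V, ∀ c, ∀ᶠ w'' in 𝓝 w', φ c w'' = ∑ a, g c a w'' • omegaForm i a w'' :=
    fun w' hw' c => Filter.eventually_of_mem (hV.mem_nhds hw') (hgφ c)
  have hg' : ∀ w' ∈ V, ∀ c a, ContDiffAt ℝ ∞ (g c a) w' :=
    fun w' hw' c a => (hg c a).contDiffAt (hV.mem_nhds hw')
  have hiso' : ∀ c d, ∀ᶠ w' in 𝓝 w,
      (g c 1 w' * b₁ w' - g c 2 w' * a₁ w') * (g d 1 w' * b₂ w' - g d 2 w' * a₂ w') +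
        (g c 1 w' * b₂ w' - g c 2 w' * a₂ w') * (g d 1 w' * b₁ w' - g d 2 w' * a₁ w') = 0 := by
    intro c d
    filter_upwards [hf, hnear] with w' h1 h2
    obtain ⟨u, hu⟩ := h1.tangent₁
    obtain ⟨u', hu'⟩ := h1.tangent₂
    exact (pairing_eq_zero_iff h1.smooth h1.lift hu hu' h1.indep (hφ' w' h2 c) (hφ' w' h2 d)
      (fun a => (hg' w' h2 c a).differentiableAt (by simp))
      (fun a => (hg' w' h2 d a).differentiableAt (by simp))).1
      (hiso _ (mem_generated V φ c) _ (mem_generated V φ d) w' h2)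
  by_cases h : ∃ c, g c 1 w * b₂ w - g c 2 w * a₂ w ≠ 0
  · obtain ⟨c, hc⟩ := h
    exact Or.inl (isBranch_of_ne_zero hf (hφ' w hw) (hg' w hw) (hli w hw) hiso' hc)
  by_cases h' : ∃ c, g c 1 w * b₁ w - g c 2 w * a₁ w ≠ 0
  · obtain ⟨c, hc⟩ := h'
    refine Or.inr (isBranch_of_ne_zero (hf.mono fun _ h => h.symm) (hφ' w hw) (hg' w hw) (hli w hw)
      (fun c d => (hiso' c d).mono fun w' h => ?_) hc)
    rw [← h, add_comm]
  exfalso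
  -- If both linear forms vanish on every generator, independence of the null directions makes all
  -- generators multiples of ω¹ at `w`, against rank two.
  push Not at h h'
  have hfw := hf.self_of_nhds
  have h1 : ∀ c, g c 1 w = 0 := fun c => by
    apply mul_left_cancel₀ hfw.indep
    linear_combination a₁ w * h c - a₂ w * h' c
  have h2 : ∀ c, g c 2 w = 0 := fun c => by
    apply mul_left_cancel₀ hfw.indep
    linear_combination b₁ w * h c - b₂ w * h' c
  have h3 : ∀ c, φ c w = g c 0 w • omegaForm i 0 w := fun c => by
    rw [hgφ c w hw, Fin.sum_univ_three, h1, h2]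
    simp
  have hli' := Fintype.linearIndependent_iff.1 (hli w hw)
  have h4 := hli' ![g 1 0 w, -g 0 0 w] (by
    simp only [Fin.sum_univ_two, h3, smul_smul, Matrix.cons_val_zero, Matrix.cons_val_one]
    rw [← add_smul]
    ring_nf
    simp)
  have h5 : g 0 0 w = 0 := by simpa using h4 1
  exact (hli w hw).ne_zero 0 (by simp [h3, h5])

theorem isCharacteristicSystem_charGen (hf : ∀ w' ∈ V, CharFrame i a₁ b₁ a₂ b₂ w')
    (hV : IsOpen V) :
    IsCharacteristicSystem i V (generated V (charGen i a₁ b₁)) := by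
  refine ⟨⟨_, rfl, ?_, ?_⟩, ?_⟩
  · intro c
    fin_cases c
    · exact mem_generated V (omegaForm i) 0
    · refine ⟨![0, a₁, b₁], fun a => ?_, fun w' _ => by simp [Fin.sum_univ_three, charGen]⟩
      fin_cases a
      · exact contDiffOn_const
      · exact fun w' hw' => (hf w' hw').smooth_a₁.contDiffWithinAt
      · exact fun w' hw' => (hf w' hw').smooth_b₁.contDiffWithinAt
  · intro w' hw'
    rw [Fintype.linearIndependent_iff]
    intro c hc
    have h1 : ∀ v, c 0 * omegaForm i 0 w' ![v] + c 1 * (a₁ w' * omegaForm i 1 w' ![v] +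
        b₁ w' * omegaForm i 2 w' ![v]) = 0 := fun v => by
      have := congrArg (fun α => α ![v]) hc
      simp [Fin.sum_univ_two, charGen] at this
      rw [← this]
      ring
    obtain ⟨v, h2, h3, h4, h5, h6⟩ := (hf w' hw').lift 0 0 1 0 0
    obtain ⟨v', h2', h3', h4', h5', h6'⟩ := (hf w' hw').lift 0 0 0 (a₁ w') (b₁ w')
    have p1 := h1 v
    have p2 := h1 v'
    simp [omegaForm_apply, h2, h3, h4, h5, h6] at p1
    simp [omegaForm_apply, h2', h3', h4', h5', h6'] at p2
    intro k
    fin_cases k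
    · exact p1
    · refine p2.resolve_right fun h => (hf w' hw').sq_add_sq_ne_zero ?_
      linear_combination h
  · rintro η ⟨g, hg, hη⟩ ζ ⟨h, hh, hζ⟩ w' hw'
    have h1 := hf w' hw'
    obtain ⟨u, hu⟩ := h1.tangent₁
    obtain ⟨u', hu'⟩ := h1.tangent₂
    have key : ∀ {η : OneForm} {g : Fin 2 → Param → ℝ},
        (∀ w ∈ V, η w = ∑ a, g a w • charGen i a₁ b₁ a w) → ∀ᶠ w'' in 𝓝 w',
        η w'' = ∑ a, (![g 0, fun w => g 1 w * a₁ w, fun w => g 1 w * b₁ w] : Fin 3 → Param → ℝ) a w''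
          • omegaForm i a w'' := by
      intro η g hη
      filter_upwards [hV.mem_nhds hw'] with w'' hw''
      rw [hη w'' hw'']
      simp [Fin.sum_univ_two, Fin.sum_univ_three, charGen, smul_smul, add_assoc]
    have key' : ∀ {g : Fin 2 → Param → ℝ}, (∀ a, ContDiffOn ℝ ∞ (g a) V) → ∀ a,
        DifferentiableAt ℝ ((![g 0, fun w => g 1 w * a₁ w, fun w => g 1 w * b₁ w] :
          Fin 3 → Param → ℝ) a) w' := by
      intro g hg a
      have hg' := fun a => ((hg a).contDiffAt (hV.mem_nhds hw')).differentiableAt (by simp)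
      fin_cases a
      · exact hg' 0
      · exact (hg' 1).mul (h1.smooth_a₁.differentiableAt (by simp))
      · exact (hg' 1).mul (h1.smooth_b₁.differentiableAt (by simp))
    rw [pairing_eq_zero_iff h1.smooth h1.lift hu hu' h1.indep (key hη) (key hζ) (key' hg) (key' hh)]
    simp
    ring

theorem CharFrame.span_ne (h : CharFrame i a₁ b₁ a₂ b₂ w) :
    Submodule.span ℝ (Set.range fun c => charGen i a₁ b₁ c w) ≠
      Submodule.span ℝ (Set.range fun c => charGen i a₂ b₂ c w) := by
  intro heq
  have h1 : charGen i a₁ b₁ 1 w ∈ Submodule.span ℝ (Set.range fun c => charGen i a₂ b₂ c w) := by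
    rw [← heq]
    exact Submodule.subset_span ⟨1, rfl⟩
  obtain ⟨c, d, hcd⟩ := mem_span_charGen.1 h1
  obtain ⟨v, h2, h3, h4, h5, h6⟩ := h.lift 0 0 0 1 0
  obtain ⟨v', h2', h3', h4', h5', h6'⟩ := h.lift 0 0 0 0 1
  have p1 := hcd v
  have p2 := hcd v'
  simp [charGen, omegaForm_apply, h2, h3, h4, h5, h6] at p1
  simp [charGen, omegaForm_apply, h2', h3', h4', h5', h6'] at p2
  exact h.indep (by rw [p1, p2]; ring)

theorem isBranch_charGen (h : CharFrame i a₁ b₁ a₂ b₂ w) :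
    IsBranch i V (generated V (charGen i a₁ b₁)) w a₁ b₁ := by
  refine ⟨_, fun c d _ => if c = d then 1 else 0, rfl, ?_, ?_, ?_, ?_⟩
  · exact differentiableAt_charGen h.smooth (h.smooth_a₁.differentiableAt (by simp))
      (h.smooth_b₁.differentiableAt (by simp))
  · exact fun c => Filter.Eventually.of_forall fun w' => by simp
  · exact fun c d => differentiableAt_const _
  · simp [Matrix.det_fin_two]

/-- The classes of the characteristic pair are those of its two branches. -/
theorem hasClassesAt_iff {S : Set Param} (hS : IsOpen S) (hw : w ∈ S)
    (hf : ∀ᶠ w' in 𝓝 w, CharFrame i a₁ b₁ a₂ b₂ w') {n₁ n₂ : ℕ}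
    (h₁ : ∀ V M, IsOpen V → w ∈ V → IsBranch i V M w a₁ b₁ → classAt M w = n₁)
    (h₂ : ∀ V M, IsOpen V → w ∈ V → IsBranch i V M w a₂ b₂ → classAt M w = n₂) (c₁ c₂ : ℕ) :
    HasClassesAt i S w c₁ c₂ ↔ (c₁ = n₁ ∧ c₂ = n₂) ∨ (c₁ = n₂ ∧ c₂ = n₁) := by
  have hfw := hf.self_of_nhds
  constructor
  · rintro ⟨V, -, hV, hwV, M₁, M₂, ⟨hM₁, hM₂, hne⟩, rfl, rfl⟩
    have hne' := hne w hwV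
    rcases hM₁.isBranch hV hwV hf with hb₁ | hb₁ <;> rcases hM₂.isBranch hV hwV hf with hb₂ | hb₂
    · exact absurd ((hb₁.valuesAt_eq hwV).trans (hb₂.valuesAt_eq hwV).symm) hne'
    · exact Or.inl ⟨h₁ _ _ hV hwV hb₁, h₂ _ _ hV hwV hb₂⟩
    · exact Or.inr ⟨h₂ _ _ hV hwV hb₁, h₁ _ _ hV hwV hb₂⟩
    · exact absurd ((hb₁.valuesAt_eq hwV).trans (hb₂.valuesAt_eq hwV).symm) hne'
  · obtain ⟨V, hVsub, hV, hwV⟩ := mem_nhds_iff.1 (Filter.inter_mem hf (hS.mem_nhds hw))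
    have hfV : ∀ w' ∈ V, CharFrame i a₁ b₁ a₂ b₂ w' := fun w' hw' => (hVsub hw').1
    have hM₁ := isCharacteristicSystem_charGen hfV hV
    have hM₂ := isCharacteristicSystem_charGen (fun w' hw' => (hfV w' hw').symm) hV
    have hne : ∀ w' ∈ V, valuesAt (generated V (charGen i a₁ b₁)) w' ≠
        valuesAt (generated V (charGen i a₂ b₂)) w' := fun w' hw' => by
      rw [valuesAt_generated _ hw', valuesAt_generated _ hw']
      exact (hfV w' hw').span_ne
    have hc₁ := h₁ V _ hV hwV (isBranch_charGen hfw)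
    have hc₂ := h₂ V _ hV hwV (isBranch_charGen hfw.symm)
    rintro (⟨rfl, rfl⟩ | ⟨rfl, rfl⟩)
    · exact ⟨V, fun _ h => (hVsub h).2, hV, hwV, _, _, ⟨hM₁, hM₂, hne⟩, hc₁, hc₂⟩
    · exact ⟨V, fun _ h => (hVsub h).2, hV, hwV, _, _,
        ⟨hM₂, hM₁, fun w' hw' => (hne w' hw').symm⟩, hc₂, hc₁⟩

end

/-! ### The null directions of a hyperbolic equation. -/

section
variable {U : Set Jet2} {F : Jet2 → ℝ} {S : Set Param} {i : Param → Jet2} {w : Param} {j : Jet2}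

theorem IsNondegenerateParametrization.mem_locus (h : IsNondegenerateParametrization U F S i)
    (hw : w ∈ S) : i w ∈ locus U F := h.image_eq ▸ Set.mem_image_of_mem i hw

theorem IsNondegenerateParametrization.contDiffAt (h : IsNondegenerateParametrization U F S i)
    (hw : w ∈ S) : ContDiffAt ℝ ∞ i w := h.smooth.contDiffAt (h.isOpen.mem_nhds hw)

theorem IsNondegenerateParametrization.fderiv_comp_eq_zero
    (h : IsNondegenerateParametrization U F S i) (hw : w ∈ S) (hF : DifferentiableAt ℝ F (i w))
    (v : Param) : fderiv ℝ F (i w) (fderiv ℝ i w v) = 0 := by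
  have h1 : F ∘ i =ᶠ[𝓝 w] fun _ => 0 :=
    Filter.eventually_of_mem (h.isOpen.mem_nhds hw) fun w' hw' => (h.mem_locus hw').2
  have h2 := h1.fderiv_eq (𝕜 := ℝ)
  rw [fderiv_comp w hF ((h.contDiffAt hw).differentiableAt (by simp))] at h2
  simpa using congrArg (fun L : Param →L[ℝ] ℝ => L v) h2

/-- The image of di is contained in ker dF, and both have dimension 7. -/
theorem IsNondegenerateParametrization.exists_fderiv_eq
    (h : IsNondegenerateParametrization U F S i) (hw : w ∈ S) (hF : DifferentiableAt ℝ F (i w))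
    (hne : fderiv ℝ F (i w) ≠ 0) {Y : Jet2} (hY : fderiv ℝ F (i w) Y = 0) :
    ∃ v, fderiv ℝ i w v = Y := by
  have hle : LinearMap.range (fderiv ℝ i w : Param →ₗ[ℝ] Jet2) ≤
      LinearMap.ker (fderiv ℝ F (i w) : Jet2 →ₗ[ℝ] ℝ) := by
    rintro _ ⟨v, rfl⟩
    exact h.fderiv_comp_eq_zero hw hF v
  have h1 : Module.finrank ℝ (LinearMap.range (fderiv ℝ i w : Param →ₗ[ℝ] Jet2)) = 7 := by
    rw [LinearMap.finrank_range_of_inj (h.maximal_rank w hw)]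
    simp
  have hne' : (fderiv ℝ F (i w) : Jet2 →ₗ[ℝ] ℝ) ≠ 0 := fun h0 =>
    hne (ContinuousLinearMap.coe_injective h0)
  have h2 := Module.Dual.finrank_ker_add_one_of_ne_zero (f := (fderiv ℝ F (i w) : Jet2 →ₗ[ℝ] ℝ)) hne'
  have h3 : Module.finrank ℝ Jet2 = 8 := by simp
  have heq := Submodule.eq_of_le_of_finrank_eq hle (by omega)
  have : Y ∈ LinearMap.range (fderiv ℝ i w : Param →ₗ[ℝ] Jet2) := heq ▸ hY
  exact this

theorem IsNondegenerateParametrization.exists_lift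
    (h : IsNondegenerateParametrization U F S i) (hw : w ∈ S) (x y z p q : ℝ) :
    ∃ v, fderiv ℝ i w v Jet2.x = x ∧ fderiv ℝ i w v Jet2.y = y ∧
      fderiv ℝ i w v Jet2.z = z ∧ fderiv ℝ i w v Jet2.p = p ∧ fderiv ℝ i w v Jet2.q = q := by
  have h1 : (![x, y, z, p, q, 0, 0, 0] : Jet2) ∈
      LinearMap.range (fderiv ℝ i w : Param →ₗ[ℝ] Jet2) ⊔
      LinearMap.ker (jetProj : Jet2 →ₗ[ℝ] Jet1) := by
    rw [h.transverse w hw]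
    trivial
  obtain ⟨_, ⟨v, rfl⟩, k, hk, hvk⟩ := Submodule.mem_sup.1 h1
  have hk' : ∀ c : Fin 5, k (Fin.castLE (by norm_num) c) = 0 := fun c => congrFun hk c
  have h2 : ∀ c, fderiv ℝ i w v c + k c = (![x, y, z, p, q, 0, 0, 0] : Jet2) c :=
    fun c => congrFun hvk c
  have e : ∀ c : Fin 5, fderiv ℝ i w v (Fin.castLE (by norm_num) c) =
      (![x, y, z, p, q, 0, 0, 0] : Jet2) (Fin.castLE (by norm_num) c) := fun c => by
    have h3 := h2 (Fin.castLE (by norm_num) c)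
    rwa [hk', add_zero] at h3
  exact ⟨v, e 0, e 1, e 2, e 3, e 4⟩

/-- The roots `F_s / 2 + ε √(F_s² / 4 - F_r F_t)` of the characteristic polynomial. -/
def charRoot (F : Jet2 → ℝ) (ε : ℝ) (j : Jet2) : ℝ := pd Jet2.s F j / 2 + ε * √(-discr F j)

theorem contDiffAt_discr (hF : ContDiffAt ℝ ∞ F j) : ContDiffAt ℝ ∞ (discr F) j :=
  ((contDiffAt_pd hF Jet2.r).mul (contDiffAt_pd hF Jet2.t)).sub
    (((contDiffAt_pd hF Jet2.s).pow 2).div_const 4)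

theorem contDiffAt_charRoot (hF : ContDiffAt ℝ ∞ F j) (hd : discr F j < 0) (ε : ℝ) :
    ContDiffAt ℝ ∞ (charRoot F ε) j :=
  ((contDiffAt_pd hF Jet2.s).div_const 2).add
    (contDiffAt_const.mul ((contDiffAt_discr hF).neg.sqrt (by linarith)))

theorem charRoot_sq (hd : discr F j < 0) {ε : ℝ} (hε : ε ^ 2 = 1) :
    charRoot F ε j ^ 2 - pd Jet2.s F j * charRoot F ε j + pd Jet2.r F j * pd Jet2.t F j = 0 := by
  have h := Real.sq_sqrt (show 0 ≤ -discr F j by linarith)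
  unfold charRoot
  have h2 : discr F j = pd Jet2.r F j * pd Jet2.t F j - (pd Jet2.s F j) ^ 2 / 4 := rfl
  linear_combination √(-discr F j) ^ 2 * hε + h - h2

/-- The two roots differ by 2√(-discr), so they cannot both be zero. A nonzero root is needed
because the null fields (λ, F_t) and (F_r, λ) may degenerate when λ = 0. -/
theorem exists_charRoot_ne_zero (hd : discr F j < 0) :
    ∃ ε : ℝ, ε ^ 2 = 1 ∧ charRoot F ε j ≠ 0 := by
  have h := Real.sqrt_pos.2 (show 0 < -discr F j by linarith)
  by_cases h1 : charRoot F 1 j = 0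
  · refine ⟨-1, by norm_num, fun h2 => ?_⟩
    unfold charRoot at h1 h2
    linarith
  · exact ⟨1, by norm_num, h1⟩

theorem fderiv_ne_zero_of_discr (hd : discr F j < 0) : fderiv ℝ F j ≠ 0 := by
  intro h
  simp [discr, pd, h] at hd

/-- For a root λ of λ² - F_sλ + F_rF_t, both (λ, F_t) and (F_r, λ) are null. Their determinant is λ²
- F_rF_t = λ(2λ - F_s) = 2ελ√(-discr), so one smooth nonzero root yields both null fields. -/
theorem charFrame_of_discr (hU : IsOpen U) (hF : ContDiffOn ℝ ∞ F U)
    (h : IsNondegenerateParametrization U F S i) (hw : w ∈ S) (hd : discr F (i w) < 0) {ε : ℝ}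
    (hε : ε ^ 2 = 1) (hl : charRoot F ε (i w) ≠ 0) :
    CharFrame i (fun w' => charRoot F ε (i w')) (fun w' => pd Jet2.t F (i w'))
      (fun w' => pd Jet2.r F (i w')) (fun w' => charRoot F ε (i w')) w := by
  have hFj : ContDiffAt ℝ ∞ F (i w) := hF.contDiffAt (hU.mem_nhds (h.mem_locus hw).1)
  have hi := h.contDiffAt hw
  have hq := charRoot_sq hd hε
  have hne := fderiv_ne_zero_of_discr hd
  have hFd := hFj.differentiableAt (by simp)
  refine ⟨hi, h.maximal_rank w hw, h.exists_lift hw, (contDiffAt_charRoot hFj hd ε).comp w hi,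
    (contDiffAt_pd hFj _).comp w hi, (contDiffAt_pd hFj _).comp w hi,
    (contDiffAt_charRoot hFj hd ε).comp w hi,
    h.exists_fderiv_eq hw hFd hne ?_, h.exists_fderiv_eq hw hFd hne ?_, ?_⟩
  · rw [fderiv_nullVec]
    linear_combination pd Jet2.t F (i w) * hq
  · rw [fderiv_nullVec]
    linear_combination pd Jet2.r F (i w) * hq
  · have h1 := Real.sqrt_pos.2 (show 0 < -discr F (i w) by linarith)
    have hε0 : ε ≠ 0 := by rintro rfl; norm_num at hε
    have h2 : charRoot F ε (i w) * (2 * ε * √(-discr F (i w))) ≠ 0 := by positivity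
    intro h3
    apply h2
    have h4 : 2 * charRoot F ε (i w) = pd Jet2.s F (i w) + 2 * ε * √(-discr F (i w)) := by
      unfold charRoot
      ring
    linear_combination h3 + hq - charRoot F ε (i w) * h4

theorem classAt_isBranch (hF : ContDiffAt ℝ ∞ F (i w)) (hd : discr F (i w) < 0)
    {A B A' B' : Jet2 → ℝ} (hA : ContDiffAt ℝ ∞ A (i w)) (hB : ContDiffAt ℝ ∞ B (i w))
    (hq : ∀ᶠ j' in 𝓝 (i w), charQuad F j' (A j') (B j') = 0)
    (hf : CharFrame i (fun w' => A (i w')) (fun w' => B (i w')) (fun w' => A' (i w'))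
      (fun w' => B' (i w')) w) {V : Set Param} {M : Set OneForm} (hV : IsOpen V) (hw : w ∈ V)
    (hM : IsBranch i V M w (fun w' => A (i w')) (fun w' => B (i w'))) :
    classAt M w = if nullHess F (i w) (A (i w)) (B (i w)) = 0 then 6 else 7 := by
  obtain ⟨φ, P, rfl, hφ, h1, hP, hdet⟩ := hM
  obtain ⟨u, hu⟩ := hf.tangent₁
  obtain ⟨u', hu'⟩ := hf.tangent₂
  have hA' := hA.differentiableAt (by simp)
  have hB' := hB.differentiableAt (by simp)
  have hi' := hf.smooth.differentiableAt (by simp)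
  obtain ⟨c6, c7⟩ := classAt_of_charGen hV hw hf.smooth (hf.smooth_a₁.differentiableAt (by simp))
    (hf.smooth_b₁.differentiableAt (by simp)) hf.injective hf.lift hu hu' hf.indep h1 hφ hP hdet
  have eA : fderiv ℝ (fun w' => A (i w')) w u = fderiv ℝ A (i w) (nullVec (A (i w)) (B (i w))) := by
    rw [← hu]
    exact DFunLike.congr_fun (fderiv_comp w hA' hi') u
  have eB : fderiv ℝ (fun w' => B (i w')) w u = fderiv ℝ B (i w) (nullVec (A (i w)) (B (i w))) := by
    rw [← hu]
    exact DFunLike.congr_fun (fderiv_comp w hB' hi') u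
  have hne : A (i w) ≠ 0 ∨ B (i w) ≠ 0 := by
    by_contra! h0
    exact hf.sq_add_sq_ne_zero (by simp [h0.1, h0.2])
  have key := stationary_iff_nullHess hF hd hA' hB' hne hq
  rw [eA, eB, Ne, key] at c7
  rw [eA, eB, key] at c6
  split_ifs with h0
  · exact c6 h0
  · exact c7 h0

/-- At a hyperbolic point, the classes of the characteristic systems are read off from the Hessian
of `F` in the two null directions. -/
theorem exists_hasClassesAt_iff (hU : IsOpen U) (hF : ContDiffOn ℝ ∞ F U)
    (h : IsNondegenerateParametrization U F S i) (hw : w ∈ S) (hd : discr F (i w) < 0) :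
    ∃ a₁ b₁ a₂ b₂ : ℝ, a₁ * b₂ - a₂ * b₁ ≠ 0 ∧ charQuad F (i w) a₁ b₁ = 0 ∧
      charQuad F (i w) a₂ b₂ = 0 ∧ ∀ c₁ c₂, HasClassesAt i S w c₁ c₂ ↔
        (c₁ = (if nullHess F (i w) a₁ b₁ = 0 then 6 else 7) ∧
          c₂ = (if nullHess F (i w) a₂ b₂ = 0 then 6 else 7)) ∨
        (c₁ = (if nullHess F (i w) a₂ b₂ = 0 then 6 else 7) ∧
          c₂ = (if nullHess F (i w) a₁ b₁ = 0 then 6 else 7)) := by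
  obtain ⟨ε, hε, hl⟩ := exists_charRoot_ne_zero hd
  have hFj : ContDiffAt ℝ ∞ F (i w) := hF.contDiffAt (hU.mem_nhds (h.mem_locus hw).1)
  have hi := h.contDiffAt hw
  have hroot := contDiffAt_charRoot hFj hd ε
  have ed : ∀ᶠ j' in 𝓝 (i w), discr F j' < 0 :=
    (contDiffAt_discr hFj).continuousAt.eventually_lt_const hd
  have el : ∀ᶠ j' in 𝓝 (i w), charRoot F ε j' ≠ 0 := hroot.continuousAt.eventually_ne hl
  have hf : ∀ᶠ w' in 𝓝 w, CharFrame i (fun w' => charRoot F ε (i w'))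
      (fun w' => pd Jet2.t F (i w')) (fun w' => pd Jet2.r F (i w'))
      (fun w' => charRoot F ε (i w')) w' := by
    filter_upwards [h.isOpen.mem_nhds hw, hi.continuousAt.eventually ed,
      hi.continuousAt.eventually el] with w' h1 h2 h3
    exact charFrame_of_discr hU hF h h1 h2 hε h3
  have hfw := hf.self_of_nhds
  have q₁ : ∀ᶠ j' in 𝓝 (i w), charQuad F j' (charRoot F ε j') (pd Jet2.t F j') = 0 := by
    filter_upwards [ed] with j' hj'
    unfold charQuad
    linear_combination pd Jet2.t F j' * charRoot_sq hj' hε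
  have q₂ : ∀ᶠ j' in 𝓝 (i w), charQuad F j' (pd Jet2.r F j') (charRoot F ε j') = 0 := by
    filter_upwards [ed] with j' hj'
    unfold charQuad
    linear_combination pd Jet2.r F j' * charRoot_sq hj' hε
  refine ⟨charRoot F ε (i w), pd Jet2.t F (i w), pd Jet2.r F (i w), charRoot F ε (i w),
    hfw.indep, q₁.self_of_nhds, q₂.self_of_nhds, fun c₁ c₂ => ?_⟩
  exact hasClassesAt_iff h.isOpen hw hf
    (fun V M hV hwV hM => classAt_isBranch hFj hd hroot (contDiffAt_pd hFj _) q₁ hfw hV hwV hM)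
    (fun V M hV hwV hM => classAt_isBranch hFj hd (contDiffAt_pd hFj _) hroot q₂ hfw.symm hV hwV hM)
    c₁ c₂

end

/-! ### The relative invariants as null Hessians, and vanishing partial derivatives. -/

section
variable {U : Set Jet2} {F f : Jet2 → ℝ} {j : Jet2}

theorem lambdaPlus_eq_charRoot (hd : discr F j < 0) : lambdaPlus F j = charRoot F 1 j := by
  rw [lambdaPlus, charRoot, abs_of_neg hd, one_mul]

theorem contDiffAt_lambdaPlus (hF : ContDiffAt ℝ ∞ F j) (hd : discr F j < 0) :
    ContDiffAt ℝ ∞ (lambdaPlus F) j := by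
  refine (contDiffAt_charRoot hF hd 1).congr_of_eventuallyEq ?_
  filter_upwards [(contDiffAt_discr hF).continuousAt.eventually_lt_const hd] with j' hj'
  exact lambdaPlus_eq_charRoot hj'

theorem lambdaPlus_sq (hd : discr F j < 0) :
    lambdaPlus F j ^ 2 - pd Jet2.s F j * lambdaPlus F j + pd Jet2.r F j * pd Jet2.t F j = 0 := by
  rw [lambdaPlus_eq_charRoot hd]
  exact charRoot_sq hd (by norm_num)

theorem two_mul_lambdaPlus_sub (F : Jet2 → ℝ) (j : Jet2) :
    2 * lambdaPlus F j - pd Jet2.s F j = 2 * √|discr F j| := by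
  rw [lambdaPlus]
  ring

theorem two_mul_lambdaPlus_sub_ne_zero (hd : discr F j < 0) :
    2 * lambdaPlus F j - pd Jet2.s F j ≠ 0 := by
  have := abs_pos.2 hd.ne
  rw [two_mul_lambdaPlus_sub]
  positivity

/-- Implicit differentiation of the quadratic equation for λ₊, which avoids differentiating the
square root. -/
theorem fderiv_lambdaPlus (hF : ContDiffAt ℝ ∞ F j) (hd : discr F j < 0) (v : Jet2) :
    (2 * lambdaPlus F j - pd Jet2.s F j) * fderiv ℝ (lambdaPlus F) j v =
      lambdaPlus F j * fderiv ℝ (pd Jet2.s F) j v - pd Jet2.t F j * fderiv ℝ (pd Jet2.r F) j v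
        - pd Jet2.r F j * fderiv ℝ (pd Jet2.t F) j v := by
  have hdt := ((contDiffAt_pd hF Jet2.t).differentiableAt (by simp)).hasFDerivAt
  have hds := ((contDiffAt_pd hF Jet2.s).differentiableAt (by simp)).hasFDerivAt
  have hdr := ((contDiffAt_pd hF Jet2.r).differentiableAt (by simp)).hasFDerivAt
  have hl := ((contDiffAt_lambdaPlus hF hd).differentiableAt (by simp)).hasFDerivAt
  have h1 := ((hl.pow 2).sub (hds.mul hl)).add (hdr.mul hdt)
  have h0 : HasFDerivAt (fun j' => lambdaPlus F j' ^ 2 - pd Jet2.s F j' * lambdaPlus F j' +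
      pd Jet2.r F j' * pd Jet2.t F j') (0 : Jet2 →L[ℝ] ℝ) j := by
    refine (hasFDerivAt_const (0 : ℝ) j).congr_of_eventuallyEq ?_
    filter_upwards [(contDiffAt_discr hF).continuousAt.eventually_lt_const hd] with j' hj'
    exact lambdaPlus_sq hj'
  have h2 := DFunLike.congr_fun (h1.unique h0) v
  simp only [add_apply, sub_apply, smul_apply, smul_eq_mul, zero_apply, nsmul_eq_mul] at h2
  push_cast at h2
  linear_combination h2

theorem fderiv_div_lambdaPlus (hF : ContDiffAt ℝ ∞ F j) (hd : discr F j < 0)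
    (hl : lambdaPlus F j ≠ 0) {G : Jet2 → ℝ} (hG : DifferentiableAt ℝ G j) (v : Jet2) :
    fderiv ℝ (fun j' => G j' / lambdaPlus F j') j v =
      (lambdaPlus F j * fderiv ℝ G j v - G j * fderiv ℝ (lambdaPlus F) j v)
        / lambdaPlus F j ^ 2 := by
  have hl' := ((contDiffAt_lambdaPlus hF hd).differentiableAt (by simp)).hasFDerivAt
  have h := hG.hasFDerivAt.mul ((hasDerivAt_inv hl).comp_hasFDerivAt j hl')
  have e : (fun j' => G j' / lambdaPlus F j') = G * (Inv.inv ∘ lambdaPlus F) := by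
    ext j'
    exact div_eq_mul_inv _ _
  rw [e, h.fderiv]
  simp
  field_simp
  ring

/-- The invariant `Ĩ₁` in terms of the Hessian in the null direction of `(λ₊, F_t)`. -/
theorem ITilde₁_eq_nullHess (hF : ContDiffAt ℝ ∞ F j) (hd : discr F j < 0)
    (hl : lambdaPlus F j ≠ 0) : ITilde₁ F j = -nullHess F j (lambdaPlus F j) (pd Jet2.t F j) /
      (lambdaPlus F j ^ 2 * (2 * lambdaPlus F j - pd Jet2.s F j)) := by
  have h1 := fderiv_div_lambdaPlus hF hd hl ((contDiffAt_pd hF Jet2.t).differentiableAt (by simp))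
    (nullVec (lambdaPlus F j) (pd Jet2.t F j))
  have h2 := fderiv_lambdaPlus hF hd (nullVec (lambdaPlus F j) (pd Jet2.t F j))
  have h3 := lambdaPlus_sq hd
  have h4 := two_mul_lambdaPlus_sub_ne_zero hd
  rw [fderiv_nullVec] at h1
  rw [eq_div_iff (pow_ne_zero 2 hl)] at h1
  rw [ITilde₁, Matrix.det_fin_three, eq_div_iff (mul_ne_zero (pow_ne_zero 2 hl) h4), nullHess]
  simp
  generalize pd Jet2.r (fun j' => pd Jet2.t F j' / lambdaPlus F j') j = Ar at *
  generalize pd Jet2.s (fun j' => pd Jet2.t F j' / lambdaPlus F j') j = As at *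
  generalize pd Jet2.t (fun j' => pd Jet2.t F j' / lambdaPlus F j') j = At at *
  generalize fderiv ℝ (lambdaPlus F) j (nullVec (lambdaPlus F j) (pd Jet2.t F j)) = Dl at *
  generalize lambdaPlus F j = l at *
  -- Modulo the quadratic equation for λ₊, the determinant is minus the derivative of F_t/λ₊ along
  -- N(λ₊, F_t). The quotient rule and the formula for dλ₊ turn this into the Hessian.
  linear_combination (-(2 * l - pd Jet2.s F j)) * h1 + pd Jet2.t F j * h2 +
    (At * l ^ 2 * (2 * l - pd Jet2.s F j) -
      fderiv ℝ (pd Jet2.t F) j (nullVec l (pd Jet2.t F j))) * h3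

/-- The invariant `Ĩ₂` in terms of the Hessian in the null direction of `(F_r, λ₊)`. -/
theorem ITilde₂_eq_nullHess (hF : ContDiffAt ℝ ∞ F j) (hd : discr F j < 0)
    (hl : lambdaPlus F j ≠ 0) : ITilde₂ F j = -nullHess F j (pd Jet2.r F j) (lambdaPlus F j) /
      (lambdaPlus F j ^ 2 * (2 * lambdaPlus F j - pd Jet2.s F j)) := by
  have h1 := fderiv_div_lambdaPlus hF hd hl ((contDiffAt_pd hF Jet2.r).differentiableAt (by simp))
    (nullVec (pd Jet2.r F j) (lambdaPlus F j))
  have h2 := fderiv_lambdaPlus hF hd (nullVec (pd Jet2.r F j) (lambdaPlus F j))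
  have h3 := lambdaPlus_sq hd
  have h4 := two_mul_lambdaPlus_sub_ne_zero hd
  rw [fderiv_nullVec] at h1
  rw [eq_div_iff (pow_ne_zero 2 hl)] at h1
  rw [ITilde₂, Matrix.det_fin_three, eq_div_iff (mul_ne_zero (pow_ne_zero 2 hl) h4), nullHess]
  simp
  generalize pd Jet2.r (fun j' => pd Jet2.r F j' / lambdaPlus F j') j = Ar at *
  generalize pd Jet2.s (fun j' => pd Jet2.r F j' / lambdaPlus F j') j = As at *
  generalize pd Jet2.t (fun j' => pd Jet2.r F j' / lambdaPlus F j') j = At at *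
  generalize fderiv ℝ (lambdaPlus F) j (nullVec (pd Jet2.r F j) (lambdaPlus F j)) = Dl at *
  generalize lambdaPlus F j = l at *
  linear_combination (-(2 * l - pd Jet2.s F j)) * h1 + pd Jet2.r F j * h2 +
    (Ar * l ^ 2 * (2 * l - pd Jet2.s F j) -
      fderiv ℝ (pd Jet2.r F) j (nullVec (pd Jet2.r F j) l)) * h3

theorem DependsOnlyOn.pd_eq_zero (hU : IsOpen U) (hF : DifferentiableAt ℝ F j) {C : Set (Fin 8)}
    (h : DependsOnlyOn U F C) (hj : j ∈ U) {k : Fin 8} (hk : k ∉ C) : pd k F j = 0 := by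
  have h1 : HasDerivAt (fun τ : ℝ => j + τ • (Pi.single k 1 : Jet2)) (Pi.single k 1) 0 := by
    simpa using ((hasDerivAt_id (0 : ℝ)).smul_const (Pi.single k 1 : Jet2)).const_add j
  have h2 : HasFDerivAt F (fderiv ℝ F j) (j + (0 : ℝ) • (Pi.single k 1 : Jet2)) := by
    simpa using hF.hasFDerivAt
  have h3 := h2.comp_hasDerivAt (0 : ℝ) h1
  have h4 : (F ∘ fun τ : ℝ => j + τ • (Pi.single k 1 : Jet2)) =ᶠ[𝓝 0] fun _ => F j := by
    have : ∀ᶠ τ in 𝓝 (0 : ℝ), j + τ • (Pi.single k 1 : Jet2) ∈ U :=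
      h1.continuousAt.eventually (hU.mem_nhds (by simpa using hj))
    filter_upwards [this] with τ hτ
    refine h _ hτ _ hj fun l hl => ?_
    have : l ≠ k := fun e => hk (e ▸ hl)
    simp [this]
  exact h3.unique ((hasDerivAt_const (0 : ℝ) (F j)).congr_of_eventuallyEq h4)

theorem DependsOnlyOn.pd_pd_eq_zero (hU : IsOpen U) (hF : ContDiffOn ℝ ∞ F U) {C : Set (Fin 8)}
    (h : DependsOnlyOn U F C) (hj : j ∈ U) {k : Fin 8} (hk : k ∉ C) (l : Fin 8) :
    pd l (pd k F) j = 0 ∧ pd k (pd l F) j = 0 := by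
  have h1 : pd k F =ᶠ[𝓝 j] fun _ => 0 := by
    filter_upwards [hU.mem_nhds hj] with j' hj'
    exact h.pd_eq_zero hU ((hF.contDiffAt (hU.mem_nhds hj')).differentiableAt (by simp)) hj' hk
  have h2 : pd l (pd k F) j = 0 := by
    rw [pd, h1.fderiv_eq]
    simp
  exact ⟨h2, by rw [pd_comm (hF.contDiffAt (hU.mem_nhds hj)), h2]⟩

end

/-! ### The types, and the three families of equations. -/

section
variable {U : Set Jet2} {F f : Jet2 → ℝ} {S : Set Param} {i : Param → Jet2} {w : Param} {j : Jet2}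

theorem exists_type_iff (hU : IsOpen U) (hF : ContDiffOn ℝ ∞ F U)
    (h : IsNondegenerateParametrization U F S i) (hw : w ∈ S) (hd : discr F (i w) < 0) :
    ∃ a₁ b₁ a₂ b₂ : ℝ, a₁ * b₂ - a₂ * b₁ ≠ 0 ∧ charQuad F (i w) a₁ b₁ = 0 ∧
      charQuad F (i w) a₂ b₂ = 0 ∧
      (IsMongeAmpereAt i S w ↔ nullHess F (i w) a₁ b₁ = 0 ∧ nullHess F (i w) a₂ b₂ = 0) ∧
      (IsGenericAt i S w ↔ nullHess F (i w) a₁ b₁ ≠ 0 ∧ nullHess F (i w) a₂ b₂ ≠ 0) ∧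
      (IsGoursatAt i S w ↔ ¬ (nullHess F (i w) a₁ b₁ = 0 ↔ nullHess F (i w) a₂ b₂ = 0)) := by
  obtain ⟨a₁, b₁, a₂, b₂, hab, h1, h2, h3⟩ := exists_hasClassesAt_iff hU hF h hw hd
  refine ⟨a₁, b₁, a₂, b₂, hab, h1, h2, ?_⟩
  unfold IsMongeAmpereAt IsGenericAt IsGoursatAt
  simp only [h3]
  by_cases p1 : nullHess F (i w) a₁ b₁ = 0 <;> by_cases p2 : nullHess F (i w) a₂ b₂ = 0 <;>
    simp [p1, p2]

/-! ### Equations not involving `s` -/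

/-- The coordinates other than `s`. -/
abbrev coordsNoS : Set (Fin 8) := {Jet2.x, Jet2.y, Jet2.z, Jet2.p, Jet2.q, Jet2.r, Jet2.t}

/-- The coordinates other than `t`. -/
abbrev coordsNoT : Set (Fin 8) := {Jet2.x, Jet2.y, Jet2.z, Jet2.p, Jet2.q, Jet2.r, Jet2.s}

/-- The coordinates other than `r`, `t`. -/
abbrev coordsNoRT : Set (Fin 8) := {Jet2.x, Jet2.y, Jet2.z, Jet2.p, Jet2.q, Jet2.s}

theorem discr_noS (hU : IsOpen U) (hF : ContDiffOn ℝ ∞ F U) (h : DependsOnlyOn U F coordsNoS)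
    (hj : j ∈ U) : discr F j = pd Jet2.r F j * pd Jet2.t F j := by
  have h0 := h.pd_eq_zero hU ((hF.contDiffAt (hU.mem_nhds hj)).differentiableAt (by simp)) hj
    (k := Jet2.s) (by decide)
  rw [discr, h0]
  ring

/-- Here Hess F(N,N) = a⁴F_tt + 2a²b²F_rt + b⁴F_rr, and nullity reads F_t a² = -F_r b². Multiplying
by F_t² and eliminating a² gives Δ. -/
theorem sq_mul_nullHess_noS (hU : IsOpen U) (hF : ContDiffOn ℝ ∞ F U)
    (h : DependsOnlyOn U F coordsNoS) (hj : j ∈ U) {a b : ℝ} (hq : charQuad F j a b = 0) :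
    pd Jet2.t F j ^ 2 * nullHess F j a b = b ^ 4 * deltaForm Jet2.r Jet2.t F j := by
  have hFj := hF.contDiffAt (hU.mem_nhds hj)
  have h0 := h.pd_eq_zero hU (hFj.differentiableAt (by simp)) hj (k := Jet2.s) (by decide)
  have hr := h.pd_pd_eq_zero hU hF hj (k := Jet2.s) (by decide) Jet2.r
  have hs := h.pd_pd_eq_zero hU hF hj (k := Jet2.s) (by decide) Jet2.s
  have ht := h.pd_pd_eq_zero hU hF hj (k := Jet2.s) (by decide) Jet2.t
  have hc := pd_comm hFj Jet2.r Jet2.t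
  rw [charQuad, h0] at hq
  rw [nullHess, fderiv_nullVec, fderiv_nullVec, fderiv_nullVec, hr.1, hr.2, hs.1, ht.1, ht.2, hc,
    deltaForm]
  linear_combination (pd Jet2.t (pd Jet2.t F) j * (pd Jet2.t F j * a ^ 2 - pd Jet2.r F j * b ^ 2)
    + 2 * pd Jet2.t F j * b ^ 2 * pd Jet2.t (pd Jet2.r F) j) * hq

theorem nullHess_noS_eq_zero_iff (hU : IsOpen U) (hF : ContDiffOn ℝ ∞ F U)
    (h : DependsOnlyOn U F coordsNoS) (hj : j ∈ U) (hd : discr F j < 0) {a b : ℝ}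
    (hq : charQuad F j a b = 0) (hab : a ≠ 0 ∨ b ≠ 0) :
    nullHess F j a b = 0 ↔ deltaForm Jet2.r Jet2.t F j = 0 := by
  have h1 := sq_mul_nullHess_noS hU hF h hj hq
  have h0 := h.pd_eq_zero hU ((hF.contDiffAt (hU.mem_nhds hj)).differentiableAt (by simp)) hj
    (k := Jet2.s) (by decide)
  rw [discr_noS hU hF h hj] at hd
  have ht : pd Jet2.t F j ≠ 0 := by
    intro h2
    simp [h2] at hd
  have hb : b ≠ 0 := by
    rintro rfl
    simp [charQuad, ht] at hq
    simp [hq] at hab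
  constructor
  · intro h2
    rw [h2, mul_zero] at h1
    exact (mul_eq_zero.1 h1.symm).resolve_left (pow_ne_zero 4 hb)
  · intro h2
    rw [h2, mul_zero] at h1
    exact (mul_eq_zero.1 h1).resolve_left (pow_ne_zero 2 ht)

theorem type_noS (hU : IsOpen U) (hF : ContDiffOn ℝ ∞ F U) (hdep : DependsOnlyOn U F coordsNoS)
    (h : IsNondegenerateParametrization U F S i) (hw : w ∈ S) (hd : discr F (i w) < 0) :
    (IsMongeAmpereAt i S w ↔ deltaForm Jet2.r Jet2.t F (i w) = 0) ∧
      (IsGenericAt i S w ↔ deltaForm Jet2.r Jet2.t F (i w) ≠ 0) ∧ ¬ IsGoursatAt i S w := by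
  obtain ⟨a₁, b₁, a₂, b₂, hab, h1, h2, h3, h4, h5⟩ := exists_type_iff hU hF h hw hd
  have hj := (h.mem_locus hw).1
  simp only [h3, h4, h5, ne_eq,
    nullHess_noS_eq_zero_iff hU hF hdep hj hd h1 (by by_contra! h; simp [h] at hab),
    nullHess_noS_eq_zero_iff hU hF hdep hj hd h2 (by by_contra! h; simp [h] at hab)]
  simp

theorem ITilde_noS (hU : IsOpen U) (hF : ContDiffOn ℝ ∞ F U) (h : DependsOnlyOn U F coordsNoS)
    (hj : j ∈ U) (hd : pd Jet2.r F j * pd Jet2.t F j < 0) :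
    ITilde₁ F j = -(pd Jet2.t F j) ^ 2 * deltaForm Jet2.r Jet2.t F j /
      (2 * (-(pd Jet2.t F j * pd Jet2.r F j)) ^ (3 / 2 : ℝ)) ∧
    ITilde₂ F j = -(pd Jet2.r F j) ^ 2 * deltaForm Jet2.r Jet2.t F j /
      (2 * (-(pd Jet2.t F j * pd Jet2.r F j)) ^ (3 / 2 : ℝ)) := by
  have hFj := hF.contDiffAt (hU.mem_nhds hj)
  have h0 := h.pd_eq_zero hU (hFj.differentiableAt (by simp)) hj (k := Jet2.s) (by decide)
  have hdisc := discr_noS hU hF h hj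
  have hd' : discr F j < 0 := hdisc ▸ hd
  have hlam : lambdaPlus F j = √(-(pd Jet2.t F j * pd Jet2.r F j)) := by
    rw [lambdaPlus, abs_of_neg hd', h0, hdisc, mul_comm (pd Jet2.r F j)]
    ring
  have hl : 0 < lambdaPlus F j := by
    rw [hlam]
    exact Real.sqrt_pos.2 (by linarith)
  have hpow : (-(pd Jet2.t F j * pd Jet2.r F j)) ^ (3 / 2 : ℝ) = lambdaPlus F j ^ 3 := by
    rw [Real.rpow_div_two_eq_sqrt _ (by linarith), ← hlam]
    exact_mod_cast Real.rpow_natCast _ 3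
  have hsq := lambdaPlus_sq hd'
  rw [h0] at hsq
  have ht : pd Jet2.t F j ≠ 0 := by
    intro h2
    simp [h2] at hd
  have n₁ := sq_mul_nullHess_noS hU hF h hj (a := lambdaPlus F j) (b := pd Jet2.t F j) (by
    rw [charQuad, h0]
    linear_combination pd Jet2.t F j * hsq)
  have n₂ := sq_mul_nullHess_noS hU hF h hj (a := pd Jet2.r F j) (b := lambdaPlus F j) (by
    rw [charQuad, h0]
    linear_combination pd Jet2.r F j * hsq)
  rw [ITilde₁_eq_nullHess hFj hd' hl.ne', ITilde₂_eq_nullHess hFj hd' hl.ne', hpow, h0, sub_zero]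
  constructor
  · field_simp
    apply mul_left_cancel₀ (pow_ne_zero 2 ht)
    linear_combination -n₁
  · field_simp
    apply mul_left_cancel₀ (pow_ne_zero 2 ht)
    linear_combination -n₂ - deltaForm Jet2.r Jet2.t F j *
      (lambdaPlus F j ^ 2 - pd Jet2.r F j * pd Jet2.t F j) * hsq

/-! ### Equations not involving `t` -/

theorem discr_noT (hU : IsOpen U) (hF : ContDiffOn ℝ ∞ F U) (h : DependsOnlyOn U F coordsNoT)
    (hj : j ∈ U) : discr F j = -(pd Jet2.s F j) ^ 2 / 4 := by
  have h0 := h.pd_eq_zero hU ((hF.contDiffAt (hU.mem_nhds hj)).differentiableAt (by simp)) hj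
    (k := Jet2.t) (by decide)
  rw [discr, h0]
  ring

theorem nullHess_noT (hU : IsOpen U) (hF : ContDiffOn ℝ ∞ F U) (h : DependsOnlyOn U F coordsNoT)
    (hj : j ∈ U) (a b : ℝ) : nullHess F j a b = b ^ 2 * (a ^ 2 * pd Jet2.s (pd Jet2.s F) j -
      2 * a * b * pd Jet2.s (pd Jet2.r F) j + b ^ 2 * pd Jet2.r (pd Jet2.r F) j) := by
  have hFj := hF.contDiffAt (hU.mem_nhds hj)
  have hr := h.pd_pd_eq_zero hU hF hj (k := Jet2.t) (by decide) Jet2.r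
  have hs := h.pd_pd_eq_zero hU hF hj (k := Jet2.t) (by decide) Jet2.s
  have ht := h.pd_pd_eq_zero hU hF hj (k := Jet2.t) (by decide) Jet2.t
  have hc := pd_comm hFj Jet2.r Jet2.s
  rw [nullHess, fderiv_nullVec, fderiv_nullVec, fderiv_nullVec, hr.1, hr.2, hs.1, hs.2, ht.1, hc]
  ring

theorem sq_mul_nullHess_noT (hU : IsOpen U) (hF : ContDiffOn ℝ ∞ F U)
    (h : DependsOnlyOn U F coordsNoT) (hj : j ∈ U) {a b : ℝ}
    (hq : pd Jet2.r F j * b = pd Jet2.s F j * a) :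
    pd Jet2.s F j ^ 2 * nullHess F j a b = b ^ 4 * deltaForm Jet2.r Jet2.s F j := by
  rw [nullHess_noT hU hF h hj, deltaForm]
  linear_combination (-(pd Jet2.r F j * b + pd Jet2.s F j * a) * b ^ 2 * pd Jet2.s (pd Jet2.s F) j
    + 2 * b ^ 3 * pd Jet2.s F j * pd Jet2.s (pd Jet2.r F) j) * hq

/-- With F_t = 0 the characteristic form factors as b(F_r b - F_s a). The direction b = 0 has N
parallel to ∂_t, where the Hessian vanishes identically, so only the other direction sees Δ. The
disjunction records that either label may carry b = 0. -/
theorem nullHess_noT_eq_zero (hU : IsOpen U) (hF : ContDiffOn ℝ ∞ F U)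
    (h : DependsOnlyOn U F coordsNoT) (hj : j ∈ U) (hs : pd Jet2.s F j ≠ 0) {a b a' b' : ℝ}
    (hq : charQuad F j a b = 0) (hq' : charQuad F j a' b' = 0) (hab : a * b' - a' * b ≠ 0) :
    (nullHess F j a b = 0 ∧ (nullHess F j a' b' = 0 ↔ deltaForm Jet2.r Jet2.s F j = 0)) ∨
    (nullHess F j a' b' = 0 ∧ (nullHess F j a b = 0 ↔ deltaForm Jet2.r Jet2.s F j = 0)) := by
  have h0 := h.pd_eq_zero hU ((hF.contDiffAt (hU.mem_nhds hj)).differentiableAt (by simp)) hj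
    (k := Jet2.t) (by decide)
  have key : ∀ {a b : ℝ}, charQuad F j a b = 0 → b ≠ 0 →
      pd Jet2.r F j * b = pd Jet2.s F j * a := by
    intro a b hq hb
    rw [charQuad, h0] at hq
    apply mul_left_cancel₀ hb
    linear_combination hq
  have key' : ∀ {a b : ℝ}, charQuad F j a b = 0 → b ≠ 0 →
      (nullHess F j a b = 0 ↔ deltaForm Jet2.r Jet2.s F j = 0) := by
    intro a b hq hb
    have h1 := sq_mul_nullHess_noT hU hF h hj (key hq hb)
    constructor <;> intro h2 <;> rw [h2, mul_zero] at h1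
    · exact (mul_eq_zero.1 h1.symm).resolve_left (pow_ne_zero 4 hb)
    · exact (mul_eq_zero.1 h1).resolve_left (pow_ne_zero 2 hs)
  by_cases hb : b = 0
  · refine Or.inl ⟨by rw [nullHess_noT hU hF h hj, hb]; ring, key' hq' ?_⟩
    rintro rfl
    simp [hb] at hab
  · have hb' : b' = 0 := by
      by_contra hb'
      apply mul_ne_zero hs hab
      linear_combination b * key hq' hb' - b' * key hq hb
    exact Or.inr ⟨by rw [nullHess_noT hU hF h hj, hb']; ring, key' hq hb⟩

theorem type_noT (hU : IsOpen U) (hF : ContDiffOn ℝ ∞ F U) (hdep : DependsOnlyOn U F coordsNoT)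
    (h : IsNondegenerateParametrization U F S i) (hw : w ∈ S) (hd : discr F (i w) < 0) :
    (IsMongeAmpereAt i S w ↔ deltaForm Jet2.r Jet2.s F (i w) = 0) ∧
      (IsGoursatAt i S w ↔ deltaForm Jet2.r Jet2.s F (i w) ≠ 0) ∧ ¬ IsGenericAt i S w := by
  obtain ⟨a₁, b₁, a₂, b₂, hab, h1, h2, h3, h4, h5⟩ := exists_type_iff hU hF h hw hd
  have hj := (h.mem_locus hw).1
  have hs : pd Jet2.s F (i w) ≠ 0 := by
    intro h0
    rw [discr_noT hU hF hdep hj, h0] at hd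
    norm_num at hd
  rw [h3, h4, h5]
  rcases nullHess_noT_eq_zero hU hF hdep hj hs h1 h2 hab with ⟨p, q⟩ | ⟨p, q⟩ <;> simp [p, q]

theorem ITilde_noT (hU : IsOpen U) (hF : ContDiffOn ℝ ∞ F U) (h : DependsOnlyOn U F coordsNoT)
    (hj : j ∈ U) (hs : 0 < pd Jet2.s F j) :
    ITilde₁ F j = 0 ∧ ITilde₂ F j = -deltaForm Jet2.r Jet2.s F j / pd Jet2.s F j := by
  have hFj := hF.contDiffAt (hU.mem_nhds hj)
  have h0 := h.pd_eq_zero hU (hFj.differentiableAt (by simp)) hj (k := Jet2.t) (by decide)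
  have hdisc := discr_noT hU hF h hj
  have hd : discr F j < 0 := by
    rw [hdisc]
    have := pow_pos hs 2
    linarith
  have hlam : lambdaPlus F j = pd Jet2.s F j := by
    rw [lambdaPlus, abs_of_neg hd, hdisc,
      show -(-(pd Jet2.s F j) ^ 2 / 4) = (pd Jet2.s F j / 2) ^ 2 by ring,
      Real.sqrt_sq (by linarith)]
    ring
  have hl : lambdaPlus F j ≠ 0 := hlam ▸ hs.ne'
  have n₁ := nullHess_noT hU hF h hj (lambdaPlus F j) (pd Jet2.t F j)
  have n₂ := sq_mul_nullHess_noT hU hF h hj (a := pd Jet2.r F j) (b := lambdaPlus F j) (by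
    rw [hlam, mul_comm])
  rw [h0] at n₁
  rw [ITilde₁_eq_nullHess hFj hd hl, ITilde₂_eq_nullHess hFj hd hl, h0, n₁]
  rw [hlam] at n₂ ⊢
  constructor
  · simp
  · have hs' := hs.ne'
    rw [show 2 * pd Jet2.s F j - pd Jet2.s F j = pd Jet2.s F j by ring]
    field_simp
    apply mul_left_cancel₀ (pow_ne_zero 2 hs')
    linear_combination -n₂

/-! ### Equations `r t = f` -/

/-- The function `σ r t + τ f`. -/
def rtComb (σ τ : ℝ) (f : Jet2 → ℝ) (j : Jet2) : ℝ := σ * (j Jet2.r * j Jet2.t) + τ * f j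

theorem pd_rtComb (hf : DifferentiableAt ℝ f j) (σ τ : ℝ) (k : Fin 8) : pd k (rtComb σ τ f) j =
    σ * ((if k = Jet2.r then 1 else 0) * j Jet2.t + j Jet2.r * (if k = Jet2.t then 1 else 0)) +
      τ * pd k f j := by
  have h1 (k : Fin 8) :=
    (ContinuousLinearMap.proj (R := ℝ) (φ := fun _ : Fin 8 => ℝ) k).hasFDerivAt (x := j)
  have h : HasFDerivAt (rtComb σ τ f) _ j :=
    (((h1 Jet2.r).fun_mul (h1 Jet2.t)).const_mul σ).fun_add (hf.hasFDerivAt.const_mul τ)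
  rw [pd, h.fderiv]
  simp [pd, Pi.single_apply, eq_comm]
  split_ifs <;> ring

end

section
variable {U : Set Jet2} {F f : Jet2 → ℝ} {S : Set Param} {i : Param → Jet2} {w : Param} {j : Jet2}

theorem contDiffOn_rtComb (hf : ContDiffOn ℝ ∞ f U) (σ τ : ℝ) :
    ContDiffOn ℝ ∞ (rtComb σ τ f) U := by
  unfold rtComb
  fun_prop

theorem pd_rtComb_r (hU : IsOpen U) (hf : ContDiffOn ℝ ∞ f U) (h : DependsOnlyOn U f coordsNoRT)
    (hj : j ∈ U) (σ τ : ℝ) : pd Jet2.r (rtComb σ τ f) j = σ * j Jet2.t := by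
  have hd := (hf.contDiffAt (hU.mem_nhds hj)).differentiableAt (by simp)
  rw [pd_rtComb hd, h.pd_eq_zero hU hd hj (k := Jet2.r) (by decide)]
  simp [show Jet2.r ≠ Jet2.t by decide]

theorem pd_rtComb_t (hU : IsOpen U) (hf : ContDiffOn ℝ ∞ f U) (h : DependsOnlyOn U f coordsNoRT)
    (hj : j ∈ U) (σ τ : ℝ) : pd Jet2.t (rtComb σ τ f) j = σ * j Jet2.r := by
  have hd := (hf.contDiffAt (hU.mem_nhds hj)).differentiableAt (by simp)
  rw [pd_rtComb hd, h.pd_eq_zero hU hd hj (k := Jet2.t) (by decide)]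
  simp [show Jet2.t ≠ Jet2.r by decide]

theorem pd_rtComb_s (hU : IsOpen U) (hf : ContDiffOn ℝ ∞ f U)
    (hj : j ∈ U) (σ τ : ℝ) : pd Jet2.s (rtComb σ τ f) j = τ * pd Jet2.s f j := by
  rw [pd_rtComb ((hf.contDiffAt (hU.mem_nhds hj)).differentiableAt (by simp))]
  simp [show Jet2.s ≠ Jet2.t by decide, show Jet2.s ≠ Jet2.r by decide]

theorem discr_rtComb (hU : IsOpen U) (hf : ContDiffOn ℝ ∞ f U) (h : DependsOnlyOn U f coordsNoRT)
    (hj : j ∈ U) {σ τ : ℝ} (hσ : σ ^ 2 = 1) (hτ : τ ^ 2 = 1) :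
    discr (rtComb σ τ f) j = -((pd Jet2.s f j) ^ 2 - 4 * j Jet2.r * j Jet2.t) / 4 := by
  rw [discr, pd_rtComb_r hU hf h hj, pd_rtComb_s hU hf hj, pd_rtComb_t hU hf h hj]
  linear_combination j Jet2.r * j Jet2.t * hσ - (pd Jet2.s f j) ^ 2 / 4 * hτ

/-- The fibre Hessian is 2σ dr dt + τf_ss ds², and rt = s² = a²b² on N(a,b). -/
theorem nullHess_rtComb (hU : IsOpen U) (hf : ContDiffOn ℝ ∞ f U)
    (h : DependsOnlyOn U f coordsNoRT) (hj : j ∈ U) (σ τ a b : ℝ) :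
    nullHess (rtComb σ τ f) j a b =
      a ^ 2 * b ^ 2 * (2 * σ + τ * pd Jet2.s (pd Jet2.s f) j) := by
  have h1 (k : Fin 8) :=
    (ContinuousLinearMap.proj (R := ℝ) (φ := fun _ : Fin 8 => ℝ) k).hasFDerivAt (x := j)
  have er : pd Jet2.r (rtComb σ τ f) =ᶠ[𝓝 j] fun j' => σ * j' Jet2.t := by
    filter_upwards [hU.mem_nhds hj] with j' hj' using pd_rtComb_r hU hf h hj' σ τ
  have et : pd Jet2.t (rtComb σ τ f) =ᶠ[𝓝 j] fun j' => σ * j' Jet2.r := by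
    filter_upwards [hU.mem_nhds hj] with j' hj' using pd_rtComb_t hU hf h hj' σ τ
  have es : pd Jet2.s (rtComb σ τ f) =ᶠ[𝓝 j] fun j' => τ * pd Jet2.s f j' := by
    filter_upwards [hU.mem_nhds hj] with j' hj' using pd_rtComb_s hU hf hj' σ τ
  have dr : HasFDerivAt (fun j' : Jet2 => σ * j' Jet2.t) _ j := (h1 Jet2.t).const_mul σ
  have dt : HasFDerivAt (fun j' : Jet2 => σ * j' Jet2.r) _ j := (h1 Jet2.r).const_mul σ
  have hfj := hf.contDiffAt (hU.mem_nhds hj)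
  have ds := ((contDiffAt_pd hfj Jet2.s).differentiableAt (by simp)).hasFDerivAt.const_mul τ
  rw [nullHess, er.fderiv_eq, et.fderiv_eq, es.fderiv_eq, dr.fderiv, dt.fderiv, ds.fderiv]
  simp only [smul_apply, ContinuousLinearMap.proj_apply, smul_eq_mul, nullVec_r, nullVec_t,
    fderiv_nullVec]
  rw [(h.pd_pd_eq_zero hU hf hj (k := Jet2.r) (by decide) Jet2.s).2,
    (h.pd_pd_eq_zero hU hf hj (k := Jet2.t) (by decide) Jet2.s).2]
  ring

theorem ITilde_rtComb (hU : IsOpen U) (hf : ContDiffOn ℝ ∞ f U) (h : DependsOnlyOn U f coordsNoRT)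
    (hj : j ∈ U) {σ τ : ℝ} (hσ : σ ^ 2 = 1) (hτ : τ ^ 2 = 1)
    (hd : 0 < (pd Jet2.s f j) ^ 2 - 4 * j Jet2.r * j Jet2.t)
    (hl : lambdaPlus (rtComb σ τ f) j ≠ 0) :
    ITilde₁ (rtComb σ τ f) j = -(2 * σ + τ * pd Jet2.s (pd Jet2.s f) j) * (j Jet2.r) ^ 2 /
        √((pd Jet2.s f j) ^ 2 - 4 * j Jet2.r * j Jet2.t) ∧
      ITilde₂ (rtComb σ τ f) j = -(2 * σ + τ * pd Jet2.s (pd Jet2.s f) j) * (j Jet2.t) ^ 2 /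
        √((pd Jet2.s f j) ^ 2 - 4 * j Jet2.r * j Jet2.t) := by
  have hF := (contDiffOn_rtComb hf σ τ).contDiffAt (hU.mem_nhds hj)
  have hdisc := discr_rtComb hU hf h hj hσ hτ
  have hd' : discr (rtComb σ τ f) j < 0 := by
    rw [hdisc]
    linarith
  have hsqrt : 2 * lambdaPlus (rtComb σ τ f) j - pd Jet2.s (rtComb σ τ f) j =
      √((pd Jet2.s f j) ^ 2 - 4 * j Jet2.r * j Jet2.t) := by
    rw [two_mul_lambdaPlus_sub, abs_of_neg hd', hdisc, neg_div, neg_neg, Real.sqrt_div hd.le,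
      show (4 : ℝ) = 2 ^ 2 by norm_num, Real.sqrt_sq (by norm_num)]
    ring
  have hpos := Real.sqrt_pos.2 hd
  rw [ITilde₁_eq_nullHess hF hd' hl, ITilde₂_eq_nullHess hF hd' hl, nullHess_rtComb hU hf h hj,
    nullHess_rtComb hU hf h hj, hsqrt, pd_rtComb_r hU hf h hj, pd_rtComb_t hU hf h hj]
  constructor <;> field_simp <;> rw [hσ, one_mul]

theorem rt_sub_eq (f : Jet2 → ℝ) : (fun j => j Jet2.r * j Jet2.t - f j) = rtComb 1 (-1) f := by
  ext j
  rw [rtComb]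
  ring

theorem sub_rt_eq (f : Jet2 → ℝ) : (fun j => f j - j Jet2.r * j Jet2.t) = rtComb (-1) 1 f := by
  ext j
  rw [rtComb]
  ring

theorem rt_add_eq (f : Jet2 → ℝ) : (fun j => j Jet2.r * j Jet2.t + f j) = rtComb 1 1 f := by
  ext j
  rw [rtComb]
  ring

theorem isHyperbolicAt_rt_iff (hU : IsOpen U) (hf : ContDiffOn ℝ ∞ f U)
    (hdep : DependsOnlyOn U f coordsNoRT)
    (h : IsNondegenerateParametrization U (rtComb 1 (-1) f) S i) (hw : w ∈ S) :
    IsHyperbolicAt (rtComb 1 (-1) f) i w ↔ 4 * f (i w) < (pd Jet2.s f (i w)) ^ 2 := by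
  have h1 := h.mem_locus hw
  have h2 : rtComb 1 (-1) f (i w) = 0 := h1.2
  rw [rtComb] at h2
  rw [IsHyperbolicAt, discr_rtComb hU hf hdep h1.1 (by norm_num) (by norm_num)]
  constructor <;> intro h3 <;> linarith

theorem type_rt (hU : IsOpen U) (hf : ContDiffOn ℝ ∞ f U) (hdep : DependsOnlyOn U f coordsNoRT)
    (h : IsNondegenerateParametrization U (rtComb 1 (-1) f) S i) (hw : w ∈ S)
    (hd : discr (rtComb 1 (-1) f) (i w) < 0) (hrt : i w Jet2.r * i w Jet2.t ≠ 0) :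
    (IsMongeAmpereAt i S w ↔ pd Jet2.s (pd Jet2.s f) (i w) = 2) ∧
      (IsGenericAt i S w ↔ pd Jet2.s (pd Jet2.s f) (i w) ≠ 2) ∧ ¬ IsGoursatAt i S w := by
  obtain ⟨a₁, b₁, a₂, b₂, hab, h1, h2, h3, h4, h5⟩ :=
    exists_type_iff hU (contDiffOn_rtComb hf _ _) h hw hd
  have hj := (h.mem_locus hw).1
  have key : ∀ {a b : ℝ}, charQuad (rtComb 1 (-1) f) (i w) a b = 0 → a ≠ 0 ∨ b ≠ 0 →
      (nullHess (rtComb 1 (-1) f) (i w) a b = 0 ↔ pd Jet2.s (pd Jet2.s f) (i w) = 2) := by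
    intro a b hq hne
    rw [charQuad, pd_rtComb_r hU hf hdep hj, pd_rtComb_t hU hf hdep hj] at hq
    have ha : a ≠ 0 := by
      rintro rfl
      simp [right_ne_zero_of_mul hrt] at hq
      simp [hq] at hne
    have hb : b ≠ 0 := by
      rintro rfl
      simp [left_ne_zero_of_mul hrt] at hq
      simp [hq] at hne
    rw [nullHess_rtComb hU hf hdep hj, mul_eq_zero]
    constructor
    · intro h
      have := h.resolve_left (by positivity)
      linarith
    · intro h
      right
      rw [h]
      norm_num
  simp only [h3, h4, h5, ne_eq, key h1 (by by_contra! h; simp [h] at hab),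
    key h2 (by by_contra! h; simp [h] at hab)]
  simp

end

/-! ### Smooth implicit functions. -/

theorem isInvertible_comp_inr {E : Type*} [NormedAddCommGroup E] [NormedSpace ℝ E]
    {L : E × ℝ →L[ℝ] ℝ} (h : L (0, 1) ≠ 0) : (L ∘L .inr ℝ E ℝ).IsInvertible := by
  refine ⟨ContinuousLinearEquiv.unitsEquivAut ℝ (Units.mk0 _ h), ?_⟩
  ext
  simp

/-- The implicit function theorem for a smooth scalar equation, with a solution smooth at all nearby
points. -/
theorem exists_smooth_implicit {E : Type*} [NormedAddCommGroup E] [NormedSpace ℝ E]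
    [CompleteSpace E] {H : E × ℝ → ℝ} {u : E × ℝ} (hH : ∀ᶠ v in 𝓝 u, ContDiffAt ℝ ∞ H v)
    (h0 : H u = 0) (hne : fderiv ℝ H u (0, 1) ≠ 0) :
    ∃ g : E → ℝ, g u.1 = u.2 ∧ (∀ᶠ v in 𝓝 u, H v = 0 ↔ g v.1 = v.2) ∧
      ∀ᶠ x in 𝓝 u.1, ContDiffAt ℝ ∞ g x ∧ H (x, g x) = 0 := by
  have hu := hH.self_of_nhds
  have hn : (∞ : WithTop ℕ∞) ≠ 0 := by simp
  have hinv := isInvertible_comp_inr hne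
  set g := hu.implicitFunction hn hinv
  have hg0 : g u.1 = u.2 := hu.implicitFunction_apply_self hn hinv
  have hg1 : ContDiffAt ℝ ∞ g u.1 := hu.contDiffAt_implicitFunction hn hinv
  have hiff := hu.eventually_apply_eq_iff_implicitFunction hn hinv
  have hsol := hu.eventually_apply_implicitFunction hn hinv
  rw [h0] at hiff hsol
  refine ⟨g, hg0, hiff, ?_⟩
  have hcont : ContinuousAt (fun x => (x, g x)) u.1 := continuousAt_id.prodMk hg1.continuousAt
  have hu' : (u.1, g u.1) = u := by rw [hg0]
  have hne' : ∀ᶠ v in 𝓝 u, fderiv ℝ H v (0, 1) ≠ 0 := by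
    have : ContinuousAt (fun v => fderiv ℝ H v (0, 1)) u :=
      ((hu.fderiv_right (m := ∞) (by simp)).clm_apply contDiffAt_const).continuousAt
    exact this.eventually_ne hne
  have hpull : ∀ {p : E × ℝ → Prop}, (∀ᶠ v in 𝓝 u, p v) → ∀ᶠ x in 𝓝 u.1, p (x, g x) :=
    fun hp => hcont.eventually (by simpa only [hu'] using hp)
  have hcg : ∀ᶠ x in 𝓝 u.1, ContinuousAt g x :=
    ((hg1.of_le (show (1 : WithTop ℕ∞) ≤ ∞ by simp)).eventually
      (by simp)).mono fun x hx => hx.continuousAt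
  filter_upwards [hpull hH, hpull hne', hcg, hsol, hsol.eventually_nhds] with x h1 h2 h3 h4 h5
  refine ⟨?_, h4⟩
  -- Smoothness of `g` is known so far only at the base point. The implicit function based at the
  -- nearby solution `(x, g x)` is smooth at `x`, and local uniqueness identifies it with `g`.
  have hinv' := isInvertible_comp_inr h2
  have hc := h1.contDiffAt_implicitFunction hn hinv'
  refine hc.congr_of_eventuallyEq ?_
  have hc' : ContinuousAt (fun x => (x, g x)) x := continuousAt_id.prodMk h3
  filter_upwards [hc'.eventually (h1.eventually_apply_eq_iff_implicitFunction hn hinv'), h5]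
    with x' h6 h7
  exact (h6.1 (by rw [h7, h4])).symm

/-! ### The locus near a parametrized point, and curvature of affine loci. -/

section
variable {U : Set Jet2} {F : Jet2 → ℝ} {S : Set Param} {i : Param → Jet2} {w : Param} {j : Jet2}

/-- A nondegenerate parametrization is locally onto the locus. -/
theorem IsNondegenerateParametrization.eventually_locus
    (h : IsNondegenerateParametrization U F S i) (hw : w ∈ S) (hF : ContDiffAt ℝ ∞ F (i w))
    (hne : fderiv ℝ F (i w) ≠ 0) {p : Jet2 → Prop} (hp : ∀ᶠ w' in 𝓝 w, p (i w')) :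
    ∀ᶠ j in 𝓝 (i w), j ∈ locus U F → p j := by
  have hFd := hF.differentiableAt (by simp)
  -- With π a left inverse of di, the map (π, F) is a local diffeomorphism at `i w`, and π ∘ i is
  -- open at `w`. A nearby point `j` of the locus then shares its π-value with some `i w'` and its
  -- F-value 0 as well, so the two coincide.
  obtain ⟨l, hl⟩ := LinearMap.exists_leftInverse_of_injective
    (fderiv ℝ i w : Param →ₗ[ℝ] Jet2) (LinearMap.ker_eq_bot.2 (h.maximal_rank w hw))
  set π : Jet2 →L[ℝ] Param := LinearMap.toContinuousLinearMap l
  have hπ : ∀ v, π (fderiv ℝ i w v) = v := fun v => LinearMap.congr_fun hl v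
  have hi : HasStrictFDerivAt i (fderiv ℝ i w) w := (h.contDiffAt hw).hasStrictFDerivAt (by simp)
  have h1 : HasStrictFDerivAt (fun w' => π (i w')) (π ∘L fderiv ℝ i w) w :=
    π.hasStrictFDerivAt.comp w hi
  have hsurj : (π ∘L fderiv ℝ i w).range = ⊤ :=
    LinearMap.range_eq_top.2 fun v => ⟨v, hπ v⟩
  have hmap := h1.map_nhds_eq_of_surj hsurj
  have h2 : HasStrictFDerivAt (fun j => (π j, F j)) (π.prod (fderiv ℝ F (i w))) (i w) :=
    π.hasStrictFDerivAt.prodMk (hF.hasStrictFDerivAt (by simp))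
  have hinj : Function.Injective (π.prod (fderiv ℝ F (i w)) : Jet2 →ₗ[ℝ] Param × ℝ) := by
    refine (injective_iff_map_eq_zero _).2 fun v hv => ?_
    have hv1 : π v = 0 := congrArg Prod.fst hv
    have hv2 : fderiv ℝ F (i w) v = 0 := congrArg Prod.snd hv
    obtain ⟨u, rfl⟩ := h.exists_fderiv_eq hw hFd hne hv2
    rw [hπ] at hv1
    rw [hv1, map_zero]
  let e : Jet2 ≃L[ℝ] Param × ℝ :=
    (LinearEquiv.ofInjectiveOfFinrankEq _ hinj (by simp)).toContinuousLinearEquiv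
  have he : (e : Jet2 →L[ℝ] Param × ℝ) = π.prod (fderiv ℝ F (i w)) := by
    ext v <;> rfl
  rw [← he] at h2
  set Φ := h2.toOpenPartialHomeomorph
  have hsrc : Φ.source ∈ 𝓝 (i w) :=
    Φ.open_source.mem_nhds h2.mem_toOpenPartialHomeomorph_source
  have hA : ∀ᶠ w' in 𝓝 w, p (i w') ∧ w' ∈ S ∧ i w' ∈ Φ.source :=
    hp.and (Filter.Eventually.and (h.isOpen.mem_nhds hw) ((h.contDiffAt hw).continuousAt.eventually hsrc))
  have hB : (fun w' => π (i w')) '' {w' | p (i w') ∧ w' ∈ S ∧ i w' ∈ Φ.source} ∈ 𝓝 (π (i w)) := by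
    rw [← hmap]
    exact Filter.image_mem_map hA
  filter_upwards [hsrc, π.continuous.continuousAt.eventually hB] with j hj hjB hjL
  obtain ⟨w', ⟨hp', hw', hsrc'⟩, hπ'⟩ := hjB
  have : i w' = j := by
    refine Φ.injOn hsrc' hj (Prod.ext hπ' ?_)
    change F (i w') = F j
    rw [(h.mem_locus hw').2, hjL.2]
  exact this ▸ hp'

theorem fderiv_add_single (F : Jet2 → ℝ) (j : Jet2) (k l : Fin 8) (a b : ℝ) :
    fderiv ℝ F j (a • Pi.single k 1 + b • Pi.single l 1) = a * pd k F j + b * pd l F j := by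
  simp [pd]

/-- On an affine locus the fibre curvature vanishes. -/
theorem deltaForm_eq_zero_of_affine {W : Set Jet2} {k l : Fin 8} (hW : IsOpen W)
    (hF : ContDiffAt ℝ ∞ F j) (hkl : k ≠ l) (hk : ∀ v : ℝ, jetProj (v • Pi.single k 1) = 0)
    (hl : ∀ v : ℝ, jetProj (v • Pi.single l 1) = 0) {a b c : Jet1 → ℝ}
    (h : ∀ j ∈ W, j ∈ locus U F ↔ a (jetProj j) * j k + b (jetProj j) * j l + c (jetProj j) = 0)
    (hj : j ∈ W) (hjL : j ∈ locus U F) (hne : pd k F j ≠ 0 ∨ pd l F j ≠ 0) :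
    deltaForm k l F j = 0 := by
  have hj0 := (h j hj).1 hjL
  have key : ∀ v₁ v₂ : ℝ, a (jetProj j) * v₁ + b (jetProj j) * v₂ = 0 →
      v₁ * pd k F j + v₂ * pd l F j = 0 ∧ v₁ * (v₁ * pd k (pd k F) j + v₂ * pd l (pd k F) j) +
        v₂ * (v₁ * pd k (pd l F) j + v₂ * pd l (pd l F) j) = 0 := by
    intro v₁ v₂ hv
    set v : Jet2 := v₁ • Pi.single k 1 + v₂ • Pi.single l 1 with hvdef
    have hγ : ∀ τ : ℝ, HasDerivAt (fun τ : ℝ => j + τ • v) v τ := fun τ => by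
      simpa using ((hasDerivAt_id τ).smul_const v).const_add j
    have hγ0 : j + (0 : ℝ) • v = j := by simp
    have hproj : ∀ τ : ℝ, jetProj (j + τ • v) = jetProj j := fun τ => by
      rw [map_add, map_smul, hvdef, map_add, hk, hl]
      simp
    have hcont : ContinuousAt (fun τ : ℝ => j + τ • v) 0 := (hγ 0).continuousAt
    have hmem : ∀ᶠ τ in 𝓝 (0 : ℝ), j + τ • v ∈ W :=
      hcont.eventually (hW.mem_nhds (by simpa using hj))
    have hz : ∀ᶠ τ in 𝓝 (0 : ℝ), F (j + τ • v) = 0 := by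
      filter_upwards [hmem] with τ hτ
      refine ((h _ hτ).2 ?_).2
      rw [hproj]
      simp only [hvdef, Pi.add_apply, Pi.smul_apply, smul_eq_mul, Pi.single_eq_same,
        Pi.single_eq_of_ne hkl, Pi.single_eq_of_ne hkl.symm]
      linear_combination hj0 + τ * hv
    have hdiff : ∀ᶠ j' in 𝓝 j, DifferentiableAt ℝ F j' :=
      ((hF.of_le (show (1 : WithTop ℕ∞) ≤ ∞ by simp)).eventually
        (by simp)).mono fun x hx => hx.differentiableAt (by simp)
    have hdiff' : ∀ᶠ τ in 𝓝 (0 : ℝ), DifferentiableAt ℝ F (j + τ • v) :=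
      hcont.eventually (by simpa using hdiff)
    have hz' : ∀ᶠ τ in 𝓝 (0 : ℝ), v₁ * pd k F (j + τ • v) + v₂ * pd l F (j + τ • v) = 0 := by
      filter_upwards [hdiff', hz.eventually_nhds] with τ h1 h2
      have h3 := h1.hasFDerivAt.comp_hasDerivAt τ (hγ τ)
      rw [← fderiv_add_single]
      exact h3.unique ((hasDerivAt_const τ (0 : ℝ)).congr_of_eventuallyEq h2)
    refine ⟨by simpa using hz'.self_of_nhds, ?_⟩
    have hdk : HasFDerivAt (pd k F) (fderiv ℝ (pd k F) j) (j + (0 : ℝ) • v) := by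
      rw [hγ0]
      exact ((contDiffAt_pd hF k).differentiableAt (by simp)).hasFDerivAt
    have hdl : HasFDerivAt (pd l F) (fderiv ℝ (pd l F) j) (j + (0 : ℝ) • v) := by
      rw [hγ0]
      exact ((contDiffAt_pd hF l).differentiableAt (by simp)).hasFDerivAt
    have h4 := ((hdk.comp_hasDerivAt (0 : ℝ) (hγ 0)).const_mul v₁).add
      ((hdl.comp_hasDerivAt (0 : ℝ) (hγ 0)).const_mul v₂)
    have h5 := h4.unique ((hasDerivAt_const (0 : ℝ) (0 : ℝ)).congr_of_eventuallyEq hz')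
    rwa [hvdef, fderiv_add_single, fderiv_add_single] at h5
  set α := a (jetProj j)
  set β := b (jetProj j)
  -- (β, -α) spans the fibre line αv₁ + βv₂ = 0 when α, β are not both zero. If both vanish, every
  -- direction is admissible in `key`, and the first derivatives F_k and F_l are both zero, against
  -- `hne`.
  obtain ⟨h1, h2⟩ := key β (-α) (by ring)
  have hαβ : α ≠ 0 ∨ β ≠ 0 := by
    by_contra! h0
    have h3 := (key 1 0 (by simp [h0])).1
    have h4 := (key 0 1 (by simp [h0])).1
    simp only [one_mul, zero_mul, add_zero, zero_add] at h3 h4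
    simp [h3, h4] at hne
  have hc := pd_comm hF k l
  rw [hc] at h2
  unfold deltaForm
  rcases hαβ with h0 | h0
  · apply mul_left_cancel₀ (pow_ne_zero 2 h0)
    linear_combination pd k F j ^ 2 * h2 - (pd k (pd k F) j * (β * pd k F j + α * pd l F j)
      - 2 * α * pd k F j * pd l (pd k F) j) * h1
  · apply mul_left_cancel₀ (pow_ne_zero 2 h0)
    linear_combination pd l F j ^ 2 * h2 + (pd l (pd l F) j * (β * pd k F j + α * pd l F j)
      - 2 * β * pd l F j * pd l (pd k F) j) * h1

end

/-! ### Vanishing curvature makes the locus affine. -/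

/-- The inclusion of `J¹` in `J²` as the coordinate subspace `r = s = t = 0`. -/
def jetIncl : Jet1 →L[ℝ] Jet2 :=
  ContinuousLinearMap.pi fun c : Fin 8 =>
    if h : c.val < 5 then ContinuousLinearMap.proj (⟨c.val, h⟩ : Fin 5) else 0

/-- The affine slice of `J²` on which the `m`-th coordinate is `μ`, with coordinates `J¹`, `k`,
`l`. -/
def jetSlice (k l m : Fin 8) (μ : ℝ) (v : (Jet1 × ℝ) × ℝ) : Jet2 :=
  jetIncl v.1.1 + v.1.2 • Pi.single k 1 + v.2 • Pi.single l 1 + μ • Pi.single m 1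

/-- The projection of `J²` to the coordinates of `J¹`, `k`, `l`. -/
def jetCoords (k l : Fin 8) (j : Jet2) : (Jet1 × ℝ) × ℝ := ((jetProj j, j k), j l)

theorem contDiff_jetSlice (k l m : Fin 8) (μ : ℝ) : ContDiff ℝ ∞ (jetSlice k l m μ) := by
  unfold jetSlice
  fun_prop

theorem continuous_jetCoords (k l : Fin 8) : Continuous (jetCoords k l) := by
  unfold jetCoords
  fun_prop

theorem jetProj_smul_single {k : Fin 8} (hk : 5 ≤ k.val) (v : ℝ) :
    jetProj (v • Pi.single k 1) = 0 := by
  ext c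
  have : Fin.castLE (by norm_num : 5 ≤ 8) c ≠ k := by
    intro h
    have := congrArg Fin.val h
    simp at this
    omega
  simp [jetProj, this]

theorem jetSlice_jetCoords {k l m : Fin 8} (hk : 5 ≤ k.val) (hl : 5 ≤ l.val) (hm : 5 ≤ m.val)
    (hkl : k ≠ l) (hkm : k ≠ m) (hlm : l ≠ m) (μ : ℝ) (j : Jet2) :
    jetSlice k l m μ (jetCoords k l j) m = μ ∧
      ∀ c ≠ m, jetSlice k l m μ (jetCoords k l j) c = j c := by
  have hm' : ¬ m.val < 5 := by omega
  constructor
  · simp [jetSlice, jetCoords, jetIncl, hm', hkm.symm, hlm.symm]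
  · intro c hc
    have h : c = k ∨ c = l ∨ c.val < 5 := by
      simp only [Fin.ext_iff, ne_eq] at *
      omega
    rcases h with rfl | rfl | h
    · have : ¬ c.val < 5 := by omega
      simp [jetSlice, jetCoords, jetIncl, this, hkl, hkm]
    · have : ¬ c.val < 5 := by omega
      simp [jetSlice, jetCoords, jetIncl, this, hkl.symm, hlm]
    · have h1 : c ≠ k := fun e => by subst e; omega
      have h2 : c ≠ l := fun e => by subst e; omega
      simp [jetSlice, jetCoords, jetIncl, h, h1, h2, hc, jetProj]

section
variable {U : Set Jet2} {F : Jet2 → ℝ} {j₀ : Jet2}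

theorem eq_affine_of_hasDerivAt {G ρ : ℝ → ℝ} {κ₀ δ : ℝ}
    (hG : ∀ κ ∈ Metric.ball κ₀ δ, HasDerivAt G (-ρ κ) κ)
    (hρ : ∀ κ ∈ Metric.ball κ₀ δ, HasDerivAt ρ 0 κ) {κ : ℝ} (hκ : κ ∈ Metric.ball κ₀ δ) :
    G κ = G κ₀ - ρ κ₀ * (κ - κ₀) := by
  have h0 : κ₀ ∈ Metric.ball κ₀ δ := Metric.mem_ball_self (Metric.pos_of_mem_ball hκ)
  have hconn : IsPreconnected (Metric.ball κ₀ δ) := (convex_ball κ₀ δ).isPreconnected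
  have h1 : ∀ κ ∈ Metric.ball κ₀ δ, ρ κ = ρ κ₀ := fun κ hκ =>
    Metric.isOpen_ball.is_const_of_deriv_eq_zero hconn
      (fun x hx => (hρ x hx).differentiableAt.differentiableWithinAt)
      (fun x hx => (hρ x hx).deriv) hκ h0
  have h2 : ∀ κ ∈ Metric.ball κ₀ δ, HasDerivAt (fun κ => G κ + ρ κ₀ * κ) 0 κ := fun κ hκ => by
    have := (hG κ hκ).fun_add ((hasDerivAt_id κ).const_mul (ρ κ₀))
    rw [h1 κ hκ] at this
    simpa using this
  have h3 : G κ + ρ κ₀ * κ = G κ₀ + ρ κ₀ * κ₀ :=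
    Metric.isOpen_ball.is_const_of_deriv_eq_zero hconn
      (fun x hx => (h2 x hx).differentiableAt.differentiableWithinAt)
      (fun x hx => (h2 x hx).deriv) hκ h0
  linear_combination h3

/-- The slope of a solution `ℓ = G(κ)` of `F = 0` in the fibre, and its stationarity where the
curvature vanishes. -/
theorem hasDerivAt_slope {k l : Fin 8} {γ : ℝ → Jet2} {G : ℝ → ℝ} {G' κ : ℝ}
    (hF : ContDiffAt ℝ ∞ F (γ κ)) (hl : pd l F (γ κ) ≠ 0)
    (hγ : HasDerivAt γ ((1 : ℝ) • Pi.single k 1 + G' • Pi.single l 1) κ)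
    (hG : HasDerivAt G G' κ) (hz : ∀ᶠ κ' in 𝓝 κ, F (γ κ') = 0)
    (hΔ : deltaForm k l F (γ κ) = 0) :
    HasDerivAt G (-(pd k F (γ κ) / pd l F (γ κ))) κ ∧
      HasDerivAt (fun κ => pd k F (γ κ) / pd l F (γ κ)) 0 κ := by
  have h1 := (hF.differentiableAt (by simp)).hasFDerivAt.comp_hasDerivAt κ hγ
  rw [fderiv_add_single] at h1
  have h2 : 1 * pd k F (γ κ) + G' * pd l F (γ κ) = 0 :=
    h1.unique ((hasDerivAt_const κ (0 : ℝ)).congr_of_eventuallyEq hz)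
  have h3 : G' = -(pd k F (γ κ) / pd l F (γ κ)) := by
    field_simp
    linear_combination h2
  refine ⟨h3 ▸ hG, ?_⟩
  have h4 (c : Fin 8) := ((contDiffAt_pd hF c).differentiableAt
    (by simp)).hasFDerivAt.comp_hasDerivAt κ hγ
  have h5 := (h4 k).div (h4 l) hl
  rw [fderiv_add_single, fderiv_add_single] at h5
  have h6 : (1 * pd k (pd k F) (γ κ) + G' * pd l (pd k F) (γ κ)) * pd l F (γ κ) -
      pd k F (γ κ) * (1 * pd k (pd l F) (γ κ) + G' * pd l (pd l F) (γ κ)) = 0 := by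
    rw [pd_comm hF k l]
    apply mul_left_cancel₀ hl
    unfold deltaForm at hΔ
    linear_combination hΔ + (pd l F (γ κ) * pd l (pd k F) (γ κ) - pd k F (γ κ) *
      pd l (pd l F) (γ κ)) * h2
  simp only [Function.comp_apply, h6, zero_div] at h5
  exact h5

/-- Freeze the irrelevant coordinate `m` and solve F = 0 for the coordinate `l` as g(y, κ), where y
∈ J¹ and κ is the `k`-th coordinate. Vanishing Δ along the locus makes the slope F_k/F_l constant in
κ, so g is affine in κ with coefficients smooth in y. -/
theorem locusIsAffineNear_of_deltaForm (hU : IsOpen U) (hF : ContDiffOn ℝ ∞ F U) {k l m : Fin 8}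
    (hdep : DependsOnlyOn U F {m}ᶜ) (hk : 5 ≤ k.val) (hl : 5 ≤ l.val) (hm : 5 ≤ m.val)
    (hkl : k ≠ l) (hkm : k ≠ m) (hlm : l ≠ m) (hj₀ : j₀ ∈ locus U F) (hne : pd l F j₀ ≠ 0)
    (hΔ : ∀ᶠ j in 𝓝 j₀, j ∈ locus U F → deltaForm k l F j = 0) :
    LocusIsAffineNear U F k l j₀ := by
  set P := jetSlice k l m (j₀ m)
  have hP : ContDiff ℝ ∞ P := contDiff_jetSlice _ _ _ _
  have hPc : ∀ j, ∀ c ≠ m, P (jetCoords k l j) c = j c := fun j =>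
    (jetSlice_jetCoords hk hl hm hkl hkm hlm _ j).2
  have hPj : P (jetCoords k l j₀) = j₀ := by
    ext c
    by_cases hc : c = m
    · subst hc
      exact (jetSlice_jetCoords hk hl hm hkl hkm hlm _ j₀).1
    · exact hPc j₀ c hc
  have hFU : ∀ j ∈ U, ContDiffAt ℝ ∞ F j := fun j hj => hF.contDiffAt (hU.mem_nhds hj)
  set u₀ := jetCoords k l j₀
  have hPnear : ∀ {p : Jet2 → Prop}, (∀ᶠ j in 𝓝 j₀, p j) → ∀ᶠ v in 𝓝 u₀, p (P v) := fun hp =>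
    hP.continuous.continuousAt.eventually (by simpa only [hPj] using hp)
  have hPU : ∀ᶠ v in 𝓝 u₀, P v ∈ U := hPnear (hU.mem_nhds hj₀.1)
  have hPd : ∀ v : (Jet1 × ℝ) × ℝ, HasDerivAt (fun τ : ℝ => P (v.1, τ)) (Pi.single l 1) v.2 := fun v => by
    have := ((hasDerivAt_id v.2).smul_const (Pi.single l 1 : Jet2)).const_add
      (jetIncl v.1.1 + v.1.2 • Pi.single k 1) |>.add_const (j₀ m • (Pi.single m 1 : Jet2))
    rw [one_smul] at this
    exact this
  obtain ⟨g, hg0, hiff, hg⟩ := exists_smooth_implicit (H := fun v => F (P v)) (u := u₀)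
    (hPU.mono fun v hv => (hFU _ hv).comp v hP.contDiffAt) (by rw [hPj]; exact hj₀.2) (by
      have h1 : HasFDerivAt (fun v => F (P v)) _ u₀ :=
        ((hFU _ (hPU.self_of_nhds)).differentiableAt (by simp)).hasFDerivAt.comp u₀
          (hP.differentiable (by simp) u₀).hasFDerivAt
      have h2 : fderiv ℝ P u₀ (0, 1) = Pi.single l 1 := by
        have h3 : HasDerivAt (fun τ : ℝ => (u₀.1, τ)) ((0 : Jet1 × ℝ), (1 : ℝ)) u₀.2 :=
          (hasDerivAt_const _ _).prodMk (hasDerivAt_id _)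
        exact ((hP.differentiable (by simp) u₀).hasFDerivAt.comp_hasDerivAt u₀.2 h3).unique
          (hPd u₀)
      rw [h1.fderiv]
      change fderiv ℝ F (P u₀) (fderiv ℝ P u₀ (0, 1)) ≠ 0
      rw [h2, hPj]
      exact hne)
  have hgc : ContinuousAt (fun x => (x, g x)) u₀.1 :=
    continuousAt_id.prodMk hg.self_of_nhds.1.continuousAt
  have hpull : ∀ {p : Jet2 → Prop}, (∀ᶠ j in 𝓝 j₀, p j) → ∀ᶠ x in 𝓝 u₀.1, p (P (x, g x)) :=
    fun hp => hgc.eventually (by simpa only [hg0] using hPnear hp)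
  have hne' : ∀ᶠ j in 𝓝 j₀, pd l F j ≠ 0 :=
    (contDiffAt_pd (hFU _ hj₀.1) l).continuousAt.eventually_ne hne
  have hgood := hg.and ((hpull (hU.mem_nhds hj₀.1)).and ((hpull hne').and (hpull hΔ)))
  obtain ⟨δ, hδ, hball⟩ := Metric.eventually_nhds_iff_ball.1 hgood
  have hmemball : ∀ {y : Jet1} {κ : ℝ}, y ∈ Metric.ball (jetProj j₀) δ → κ ∈ Metric.ball (j₀ k) δ →
      (y, κ) ∈ Metric.ball u₀.1 δ := fun hy hκ => by
    change _ ∈ Metric.ball (jetProj j₀, j₀ k) δ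
    -- In the sup metric the ball is a product of balls, so all fibres over it are the same
    -- interval, on which the constant-slope argument runs.
    rw [← ball_prod_same]
    exact ⟨hy, hκ⟩
  have hκ₀ : j₀ k ∈ Metric.ball (j₀ k) δ := Metric.mem_ball_self hδ
  let ρ : Jet1 × ℝ → ℝ := fun x => pd k F (P (x, g x)) / pd l F (P (x, g x))
  have haff : ∀ y ∈ Metric.ball (jetProj j₀) δ, ∀ κ ∈ Metric.ball (j₀ k) δ,
      g (y, κ) = g (y, j₀ k) - ρ (y, j₀ k) * (κ - j₀ k) := by
    intro y hy κ hκ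
    have key : ∀ κ ∈ Metric.ball (j₀ k) δ,
        HasDerivAt (fun κ => g (y, κ)) (-ρ (y, κ)) κ ∧ HasDerivAt (fun κ => ρ (y, κ)) 0 κ := by
      intro κ hκ
      obtain ⟨⟨h1, h2⟩, h3, h4, h5⟩ := hball _ (hmemball hy hκ)
      have hd1 : HasDerivAt (fun κ : ℝ => (y, κ)) ((0 : Jet1), (1 : ℝ)) κ :=
        (hasDerivAt_const _ _).prodMk (hasDerivAt_id _)
      have hd2 := (h1.differentiableAt (by simp)).hasFDerivAt.comp_hasDerivAt κ hd1
      have hd3 : HasDerivAt (fun κ => P ((y, κ), g (y, κ)))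
          ((1 : ℝ) • Pi.single k 1 + (fderiv ℝ g (y, κ) (0, 1)) • Pi.single l 1) κ := by
        have := (((((hasDerivAt_id κ).smul_const (Pi.single k 1 : Jet2)).const_add (jetIncl y)).add
          (hd2.smul_const (Pi.single l 1 : Jet2))).add_const (j₀ m • (Pi.single m 1 : Jet2)))
        exact this
      refine hasDerivAt_slope (γ := fun κ => P ((y, κ), g (y, κ))) (hFU _ h3) h4 hd3 hd2 ?_
        (h5 ⟨h3, h2⟩)
      filter_upwards [Metric.isOpen_ball.mem_nhds hκ] with κ' hκ'
      exact (hball _ (hmemball hy hκ')).1.2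
    exact eq_affine_of_hasDerivAt (fun κ hκ => (key κ hκ).1) (fun κ hκ => (key κ hκ).2) hκ
  have hcoords := (continuous_jetCoords k l).continuousAt (x := j₀)
  -- Independence of `m` compares only points of `U`, so the point with frozen `m`-coordinate must
  -- be kept in `U` too.
  have hW : ∀ᶠ j in 𝓝 j₀, j ∈ U ∧ P (jetCoords k l j) ∈ U ∧
      (F (P (jetCoords k l j)) = 0 ↔ g (jetCoords k l j).1 = (jetCoords k l j).2) ∧
      jetProj j ∈ Metric.ball (jetProj j₀) δ ∧ j k ∈ Metric.ball (j₀ k) δ := by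
    refine Filter.Eventually.and (hU.mem_nhds hj₀.1) ((hcoords.eventually hPU).and
      ((hcoords.eventually hiff).and (Filter.Eventually.and ?_ ?_)))
    · exact jetProj.continuous.continuousAt.eventually (Metric.ball_mem_nhds _ hδ)
    · exact (continuous_apply k).continuousAt.eventually (Metric.ball_mem_nhds _ hδ)
  obtain ⟨W, hWsub, hWo, hjW⟩ := mem_nhds_iff.1 hW
  have himg : jetProj '' W ⊆ Metric.ball (jetProj j₀) δ := by
    rintro _ ⟨j, hj, rfl⟩
    exact (hWsub hj).2.2.2.1
  have hsmooth : ∀ y ∈ Metric.ball (jetProj j₀) δ, ContDiffAt ℝ ∞ (fun y => g (y, j₀ k)) y ∧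
      ContDiffAt ℝ ∞ (fun y => ρ (y, j₀ k)) y := by
    intro y hy
    obtain ⟨⟨h1, h2⟩, h3, h4, h5⟩ := hball _ (hmemball hy hκ₀)
    have e1 : ContDiffAt ℝ ∞ (fun y : Jet1 => (y, j₀ k)) y := by fun_prop
    have e2 : ContDiffAt ℝ ∞ (fun y => g (y, j₀ k)) y := h1.comp y e1
    have e3 : ContDiffAt ℝ ∞ (fun y => P ((y, j₀ k), g (y, j₀ k))) y :=
      hP.contDiffAt.comp y (e1.prodMk e2)
    have e4 (c : Fin 8) : ContDiffAt ℝ ∞ (fun y => pd c F (P ((y, j₀ k), g (y, j₀ k)))) y :=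
      ContDiffAt.comp (g := pd c F) y (contDiffAt_pd (hFU _ h3) c) e3
    exact ⟨e2, (e4 k).div (e4 l) h4⟩
  -- These are the coefficients of g(y,κ₀) - ρ(y,κ₀)(κ - κ₀) - ℓ = 0, where κ₀ is the `k`-th
  -- coordinate of `j₀` and ℓ the `l`-th coordinate.
  refine ⟨W, hWo, hjW, fun j hj => (hWsub hj).1, fun y => -ρ (y, j₀ k), fun _ => -1,
    fun y => g (y, j₀ k) + ρ (y, j₀ k) * j₀ k, ?_, contDiffOn_const, ?_, ?_⟩
  · exact fun y hy => (hsmooth y (himg hy)).2.neg.contDiffWithinAt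
  · exact fun y hy => ((hsmooth y (himg hy)).1.add
      ((hsmooth y (himg hy)).2.mul contDiffAt_const)).contDiffWithinAt
  · intro j hj
    obtain ⟨h1, h2, h3, h4, h5⟩ := hWsub hj
    have h6 : F (P (jetCoords k l j)) = F j := hdep _ h2 _ h1 fun c hc => hPc j c hc
    rw [h6] at h3
    have h7 : g (jetCoords k l j).1 = g (jetProj j, j k) := rfl
    rw [h7, haff _ h4 _ h5] at h3
    have h8 : (jetCoords k l j).2 = j l := rfl
    rw [h8] at h3
    have h9 : j ∈ locus U F ↔ F j = 0 := ⟨fun h => h.2, fun h => ⟨h1, h⟩⟩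
    rw [h9, h3]
    constructor <;> intro h <;> linear_combination h

end

section
variable {U : Set Jet2} {F : Jet2 → ℝ} {S : Set Param} {i : Param → Jet2} {w : Param}

theorem DependsOnlyOn.mono {C C' : Set (Fin 8)} (h : DependsOnlyOn U F C) (hC : C ⊆ C') :
    DependsOnlyOn U F C' := fun j hj j' hj' h' => h j hj j' hj' fun k hk => h' k (hC hk)

theorem eventually_deltaForm_iff (hU : IsOpen U) (hF : ContDiffOn ℝ ∞ F U) {k l m : Fin 8}
    (hdep : DependsOnlyOn U F {m}ᶜ) (hk : 5 ≤ k.val) (hl : 5 ≤ l.val) (hm : 5 ≤ m.val)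
    (hkl : k ≠ l) (hkm : k ≠ m) (hlm : l ≠ m) (h : IsNondegenerateParametrization U F S i)
    (hw : w ∈ S) (hne : pd l F (i w) ≠ 0) :
    (∀ᶠ w' in 𝓝 w, deltaForm k l F (i w') = 0) ↔ LocusIsAffineNear U F k l (i w) := by
  have hj := h.mem_locus hw
  have hFU : ∀ j ∈ U, ContDiffAt ℝ ∞ F j := fun j hj => hF.contDiffAt (hU.mem_nhds hj)
  have hic := (h.contDiffAt hw).continuousAt
  constructor
  · intro hΔ
    refine locusIsAffineNear_of_deltaForm hU hF hdep hk hl hm hkl hkm hlm hj hne ?_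
    -- The hypothesis concerns parameters near `w`. Local surjectivity onto the locus transfers it
    -- to all points of the locus near `i w`.
    refine h.eventually_locus hw (hFU _ hj.1) (fun h0 => hne ?_) hΔ
    rw [pd, h0]
    rfl
  · rintro ⟨W, hW, hjW, -, a, b, c, -, -, -, habc⟩
    have hne' : ∀ᶠ j in 𝓝 (i w), pd l F j ≠ 0 :=
      (contDiffAt_pd (hFU _ hj.1) l).continuousAt.eventually_ne hne
    filter_upwards [h.isOpen.mem_nhds hw, hic.eventually (hW.mem_nhds hjW), hic.eventually hne']
      with w' h1 h2 h3
    have h4 := h.mem_locus h1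
    exact deltaForm_eq_zero_of_affine hW (hFU _ h4.1) hkl (jetProj_smul_single hk)
      (jetProj_smul_single hl) habc h2 h4 (Or.inr h3)

theorem eventually_discr_neg (hU : IsOpen U) (hF : ContDiffOn ℝ ∞ F U)
    (h : IsNondegenerateParametrization U F S i) (hw : w ∈ S) (hd : discr F (i w) < 0) :
    ∀ᶠ w' in 𝓝 w, w' ∈ S ∧ discr F (i w') < 0 := by
  refine Filter.Eventually.and (h.isOpen.mem_nhds hw) ?_
  exact (h.contDiffAt hw).continuousAt.eventually ((contDiffAt_discr (hF.contDiffAt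
    (hU.mem_nhds (h.mem_locus hw).1))).continuousAt.eventually_lt_const hd)

end

end

theorem mainTheorem12 :
    -- equations `F(x,y,z,p,q,r,t) = 0`
    (∀ (U : Set Jet2) (F : Jet2 → ℝ), IsOpen U → ContDiffOn ℝ ∞ F U →
      DependsOnlyOn U F {Jet2.x, Jet2.y, Jet2.z, Jet2.p, Jet2.q, Jet2.r, Jet2.t} →
      (∀ j ∈ U, pd Jet2.r F j * pd Jet2.t F j < 0 →
        ITilde₁ F j = -(pd Jet2.t F j) ^ 2 * deltaForm Jet2.r Jet2.t F j /
          (2 * (-(pd Jet2.t F j * pd Jet2.r F j)) ^ (3 / 2 : ℝ)) ∧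
        ITilde₂ F j = -(pd Jet2.r F j) ^ 2 * deltaForm Jet2.r Jet2.t F j /
          (2 * (-(pd Jet2.t F j * pd Jet2.r F j)) ^ (3 / 2 : ℝ))) ∧
      (∀ (S : Set Param) (i : Param → Jet2), IsNondegenerateParametrization U F S i →
        ∀ w ∈ S,
          (IsHyperbolicAt F i w ↔ pd Jet2.r F (i w) * pd Jet2.t F (i w) < 0) ∧
          (IsHyperbolicAt F i w →
            (IsMongeAmpereAt i S w ↔ deltaForm Jet2.r Jet2.t F (i w) = 0) ∧
            (IsGenericAt i S w ↔ deltaForm Jet2.r Jet2.t F (i w) ≠ 0) ∧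
            (IsGenericAt i S w ↔ ¬ IsMongeAmpereAt i S w) ∧
            ¬ IsGoursatAt i S w ∧
            ((∀ᶠ w' in 𝓝 w, IsMongeAmpereAt i S w') ↔
              LocusIsAffineNear U F Jet2.r Jet2.t (i w))))) ∧
    -- equations `G(x,y,z,p,q,r,s) = 0`
    (∀ (U : Set Jet2) (G : Jet2 → ℝ), IsOpen U → ContDiffOn ℝ ∞ G U →
      DependsOnlyOn U G {Jet2.x, Jet2.y, Jet2.z, Jet2.p, Jet2.q, Jet2.r, Jet2.s} →
      (∀ j ∈ U, 0 < pd Jet2.s G j →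
        ITilde₁ G j = 0 ∧
        ITilde₂ G j = -deltaForm Jet2.r Jet2.s G j / pd Jet2.s G j) ∧
      (∀ (S : Set Param) (i : Param → Jet2), IsNondegenerateParametrization U G S i →
        ∀ w ∈ S,
          (IsHyperbolicAt G i w ↔ pd Jet2.s G (i w) ≠ 0) ∧
          (IsHyperbolicAt G i w →
            (IsMongeAmpereAt i S w ↔ deltaForm Jet2.r Jet2.s G (i w) = 0) ∧
            (IsGoursatAt i S w ↔ deltaForm Jet2.r Jet2.s G (i w) ≠ 0) ∧
            (IsGoursatAt i S w ↔ ¬ IsMongeAmpereAt i S w) ∧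
            ¬ IsGenericAt i S w ∧
            ((∀ᶠ w' in 𝓝 w, IsMongeAmpereAt i S w') ↔
              LocusIsAffineNear U G Jet2.r Jet2.s (i w))))) ∧
    -- equations `r t = f(x,y,z,p,q,s)`
    (∀ (U : Set Jet2) (f : Jet2 → ℝ), IsOpen U → ContDiffOn ℝ ∞ f U →
      DependsOnlyOn U f {Jet2.x, Jet2.y, Jet2.z, Jet2.p, Jet2.q, Jet2.s} →
      (∀ j ∈ U, 0 < (pd Jet2.s f j) ^ 2 - 4 * j Jet2.r * j Jet2.t →
        (lambdaPlus (fun j' => j' Jet2.r * j' Jet2.t - f j') j ≠ 0 →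
          ITilde₁ (fun j' => j' Jet2.r * j' Jet2.t - f j') j =
            (pd Jet2.s (pd Jet2.s f) j - 2) * (j Jet2.r) ^ 2 /
              √((pd Jet2.s f j) ^ 2 - 4 * j Jet2.r * j Jet2.t) ∧
          ITilde₂ (fun j' => j' Jet2.r * j' Jet2.t - f j') j =
            (pd Jet2.s (pd Jet2.s f) j - 2) * (j Jet2.t) ^ 2 /
              √((pd Jet2.s f j) ^ 2 - 4 * j Jet2.r * j Jet2.t)) ∧
        (lambdaPlus (fun j' => f j' - j' Jet2.r * j' Jet2.t) j ≠ 0 →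
          ITilde₁ (fun j' => f j' - j' Jet2.r * j' Jet2.t) j =
            -(pd Jet2.s (pd Jet2.s f) j - 2) * (j Jet2.r) ^ 2 /
              √((pd Jet2.s f j) ^ 2 - 4 * j Jet2.r * j Jet2.t) ∧
          ITilde₂ (fun j' => f j' - j' Jet2.r * j' Jet2.t) j =
            -(pd Jet2.s (pd Jet2.s f) j - 2) * (j Jet2.t) ^ 2 /
              √((pd Jet2.s f j) ^ 2 - 4 * j Jet2.r * j Jet2.t)) ∧
        (lambdaPlus (fun j' => j' Jet2.r * j' Jet2.t + f j') j ≠ 0 →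
          ITilde₁ (fun j' => j' Jet2.r * j' Jet2.t + f j') j =
            -(pd Jet2.s (pd Jet2.s f) j + 2) * (j Jet2.r) ^ 2 /
              √((pd Jet2.s f j) ^ 2 - 4 * j Jet2.r * j Jet2.t) ∧
          ITilde₂ (fun j' => j' Jet2.r * j' Jet2.t + f j') j =
            -(pd Jet2.s (pd Jet2.s f) j + 2) * (j Jet2.t) ^ 2 /
              √((pd Jet2.s f j) ^ 2 - 4 * j Jet2.r * j Jet2.t))) ∧
      (∀ (S : Set Param) (i : Param → Jet2),
        IsNondegenerateParametrization U (fun j => j Jet2.r * j Jet2.t - f j) S i →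
        ∀ w ∈ S,
          (IsHyperbolicAt (fun j => j Jet2.r * j Jet2.t - f j) i w ↔
            4 * f (i w) < (pd Jet2.s f (i w)) ^ 2) ∧
          (IsHyperbolicAt (fun j => j Jet2.r * j Jet2.t - f j) i w →
            i w Jet2.r * i w Jet2.t ≠ 0 →
            (IsMongeAmpereAt i S w ↔ pd Jet2.s (pd Jet2.s f) (i w) = 2) ∧
            (IsGenericAt i S w ↔ pd Jet2.s (pd Jet2.s f) (i w) ≠ 2) ∧
            ¬ IsGoursatAt i S w))) := by
  refine ⟨?_, ?_, ?_⟩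
  · intro U F hU hF hdep
    refine ⟨fun j hj hd => ITilde_noS hU hF hdep hj hd, fun S i h w hw => ?_⟩
    have hj := (h.mem_locus hw).1
    refine ⟨by rw [IsHyperbolicAt, discr_noS hU hF hdep hj], fun hd => ?_⟩
    obtain ⟨h1, h2, h3⟩ := type_noS hU hF hdep h hw hd
    refine ⟨h1, h2, by rw [h1, h2], h3, ?_⟩
    have hne : pd Jet2.t F (i w) ≠ 0 := by
      intro h0
      rw [IsHyperbolicAt, discr_noS hU hF hdep hj, h0, mul_zero] at hd
      exact lt_irrefl _ hd
    -- Hyperbolicity forces F_t ≠ 0, so the locus can be solved for `t`.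
    rw [← eventually_deltaForm_iff hU hF (m := Jet2.s) (hdep.mono (Set.subset_compl_singleton_iff.2 (by decide))) (by decide)
      (by decide) (by decide) (by decide) (by decide) (by decide) h hw hne]
    refine Filter.eventually_congr ?_
    filter_upwards [eventually_discr_neg hU hF h hw hd] with w' hw'
    exact (type_noS hU hF hdep h hw'.1 hw'.2).1
  · intro U G hU hG hdep
    refine ⟨fun j hj hs => ITilde_noT hU hG hdep hj hs, fun S i h w hw => ?_⟩
    have hj := (h.mem_locus hw).1
    have hyp : IsHyperbolicAt G i w ↔ pd Jet2.s G (i w) ≠ 0 := by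
      rw [IsHyperbolicAt, discr_noT hU hG hdep hj, ← sq_pos_iff]
      constructor <;> intro h <;> linarith
    refine ⟨hyp, fun hd => ?_⟩
    obtain ⟨h1, h2, h3⟩ := type_noT hU hG hdep h hw hd
    refine ⟨h1, h2, by rw [h1, h2], h3, ?_⟩
    rw [← eventually_deltaForm_iff hU hG (m := Jet2.t) (hdep.mono (Set.subset_compl_singleton_iff.2 (by decide))) (by decide)
      (by decide) (by decide) (by decide) (by decide) (by decide) h hw (hyp.1 hd)]
    refine Filter.eventually_congr ?_
    filter_upwards [eventually_discr_neg hU hG h hw hd] with w' hw'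
    exact (type_noT hU hG hdep h hw'.1 hw'.2).1
  · intro U f hU hf hdep
    -- The three functions are σrt + τf with signs (1,-1), (-1,1), (1,1), and the constant c in the
    -- invariants is -(2σ + τf_ss).
    simp only [rt_sub_eq, sub_rt_eq, rt_add_eq]
    refine ⟨fun j hj hd => ⟨fun hl => ?_, fun hl => ?_, fun hl => ?_⟩, fun S i h w hw =>
      ⟨isHyperbolicAt_rt_iff hU hf hdep h hw, fun hd hrt => type_rt hU hf hdep h hw hd hrt⟩⟩
    · convert ITilde_rtComb hU hf hdep hj (by norm_num) (by norm_num) hd hl using 4 <;> ring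
    · convert ITilde_rtComb hU hf hdep hj (by norm_num) (by norm_num) hd hl using 4 <;> ring
    · convert ITilde_rtComb hU hf hdep hj (by norm_num) (by norm_num) hd hl using 4 <;> ring
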